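/- Let $X$ be a measurable space (for instance, any set with the $\sigma$-algebra of all its subsets), $H$ a class of measurable functions $X\to\{0,1\}$ and $S\subseteq X$. A set $T\subseteq X$ is \emph{shattered} by $H$ if every labelling $\ell:T\to\{0,1\}$ is the restriction to $T$ of some $f\in H$. Put $$\mathsf{VC}_S(H)=\max\{k:\ \text{some } T\subseteq S \text{ with } |T|=k \text{ is shattered by } H\},$$ $$\mathsf{LVC}_S(H)=\max\{k\le |S|:\ \text{every } T\subseteq S \text{ with } |T|=k \text{ is shattered by } H\}.$$ For a probability distribution $D$ on $X$ let $\mathrm{dist}_D(f,H)=\inf_{h\in H}\Pr_{x\sim D}[f(x)\ne h(x)]$. A \emph{distribution-free sample $\epsilon$-tester} for $H$ with sample complexity $m$ is a randomized algorithm which, for every probability distribution $D$ on $X$ and every measurable $f:X\to\{0,1\}$, receives $m$ labelled examples $(x_i,f(x_i))$ with $x_1,\dots,x_m$ drawn independently from $D$, accepts with probability at least $2/3$ if $f\in H$, and rejects with probability at least $2/3$ if $\mathrm{dist}_D(f,H)>\epsilon$. Let $m^{\mathrm{test}}_\epsilon(H)\in\mathbb N\cup\{\infty\}$ be the least $m$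 for which such a tester exists. \textbf{Theorem.} There are absolute constants $C,\epsilon_0,c>0$ such that for every measurable space $X$, every class $H$ of measurable functions $X\to\{0,1\}$ and every $S\subseteq X$ with $2\le \mathsf{VC}_S(H)<\infty$ and $|S|\ge 5\,\mathsf{VC}_S(H)$ ($S$ may be infinite), the following hold for all $0<\epsilon<\epsilon_0$. 1. If $\mathsf{LVC}_S(H)\ge C\cdot \mathsf{VC}_S(H)^{3/4}\sqrt{\log \mathsf{VC}_S(H)}$, then $$m^{\mathrm{test}}_\epsilon(H)\ \ge\ c\cdot\frac{\mathsf{LVC}_S(H)^2}{\mathsf{VC}_S(H)\,\log \mathsf{VC}_S(H)}.$$ 2. If $\mathsf{LVC}_S(H)=\mathsf{VC}_S(H)$, then $$m^{\mathrm{test}}_\epsilon(H)\ \ge\ c\cdot\frac{\mathsf{VC}_S(H)}{\log \mathsf{VC}_S(H)}.$$ -/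

import Mathlib

open MeasureTheory
open scoped ENNReal

universe u

namespace SampleTesting

/-- `T` is shattered by `H`: every labelling of `T` is realised by a member of `H`. -/
def Shatters {X : Type u} (H : Set (X → Bool)) (T : Set X) : Prop :=
  ∀ ℓ : T → Bool, ∃ f ∈ H, ∀ x : T, f x = ℓ x

/-- The VC dimension of `H` with respect to `S`: the largest size of a subset of `S` that is
shattered by `H` (`⊤` if there are arbitrarily large ones). -/
noncomputable def vcDim {X : Type u} (H : Set (X → Bool)) (S : Set X) : ℕ∞ :=
  ⨆ k ∈ {k : ℕ | ∃ T ⊆ S, T.encard = k ∧ Shatters H T}, (k : ℕ∞)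

/-- The lower VC dimension of `H` with respect to `S`: the largest `k` such that every subset
of `S` of size `k` is shattered by `H`. Only sizes `k ≤ |S|` count: larger `k` would satisfy the
condition vacuously, and the lower VC dimension would exceed the VC dimension. -/
noncomputable def lvcDim {X : Type u} (H : Set (X → Bool)) (S : Set X) : ℕ∞ :=
  ⨆ k ∈ {k : ℕ | (k : ℕ∞) ≤ S.encard ∧ ∀ T ⊆ S, T.encard = k → Shatters H T}, (k : ℕ∞)

/-- The distance `inf_{h ∈ H} Pr_{x ∼ D}[f x ≠ h x]` from `f` to the class `H`. -/
noncomputable def distToClass {X : Type u} [MeasurableSpace X] (D : Measure X) (f : X → Bool)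
    (H : Set (X → Bool)) : ℝ≥0∞ :=
  ⨅ h ∈ H, D {x | f x ≠ h x}

/-- The sequence of labelled examples `(x i, f (x i))`. -/
def labelled {X : Type u} {m : ℕ} (f : X → Bool) (x : Fin m → X) : Fin m → X × Bool :=
  fun i => (x i, f (x i))

/-- `A` is a distribution-free sample `ε`-tester (with two-sided error) for `H` using `m` labelled
examples. `A` is a randomized algorithm: it maps a sequence of `m` labelled examples to
the probability distribution of its output, where `true` means accept and `false` means reject.
It has to succeed with probability at least `2/3`, over the `m` independent samples from `D` and
its own randomness, for every probability distribution `D` and every (measurable) function `f`.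
The measurability required of `A` is only what is needed to make these probabilities meaningful;
if `X` carries the `σ`-algebra of all subsets, `f` ranges over all functions. -/
structure IsTester {X : Type u} [MeasurableSpace X] (H : Set (X → Bool)) (ε : ℝ) (m : ℕ)
    (A : (Fin m → X × Bool) → PMF Bool) : Prop where
  aemeasurable : ∀ (D : Measure X) [IsProbabilityMeasure D] (f : X → Bool), Measurable f →
    AEMeasurable (fun x => A (labelled f x) true) (Measure.pi fun _ : Fin m => D)
  accept : ∀ (D : Measure X) [IsProbabilityMeasure D] (f : X → Bool), Measurable f → f ∈ H →
    2 / 3 ≤ ∫⁻ x, A (labelled f x) true ∂(Measure.pi fun _ : Fin m => D)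
  reject : ∀ (D : Measure X) [IsProbabilityMeasure D] (f : X → Bool), Measurable f →
    ENNReal.ofReal ε < distToClass D f H →
    2 / 3 ≤ ∫⁻ x, A (labelled f x) false ∂(Measure.pi fun _ : Fin m => D)

/-- The sample complexity of distribution-free sample-based `ε`-testing of `H`: the least `m` for
which a tester using `m` labelled examples exists (`⊤` if there is none). -/
noncomputable def sampleComplexity {X : Type u} [MeasurableSpace X] (H : Set (X → Bool))
    (ε : ℝ) : ℕ∞ :=
  ⨅ m ∈ {m : ℕ | ∃ A : (Fin m → X × Bool) → PMF Bool, IsTester H ε m A}, (m : ℕ∞)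

end SampleTesting

/-! The theorem reduces to the hardness of telling small supports from large ones. Take `n + 1 = 5
d` points of `S`, one of them (`none`) serving as a reservoir for spare mass. By Sauer–Shelah the
class has too few patterns on the other `n` points to come within Hamming distance `d / 10` of every
labelling (`exists_labelling_far`); fix a labelling that is far. A distribution supported on at most
`l` of the points must be accepted, because every set of `l` points is shattered and the labelling
therefore looks like a member of `H`. A distribution giving each of the `n` points mass at least `1
/ (160 n)` must be rejected, because the labelling is then at distance at least `1 / 8000` from `H`.
So a tester separates these two kinds of distributions (`IsTester.exists_support_test`).

That takes about `l / log d` samples (`not_distinguishes_support`). Draw the masses independently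
from one of two laws whose first `M + 1` moments agree, with `M` of order `log d`
(`exists_moment_matching`). The first law is mostly at `0` and gives small support; the second
avoids `0` and gives large masses. The acceptance probability is a polynomial in each mass, so
replacing one law by the other in a single coordinate affects only terms of degree above `M + 1`,
which are tiny (`abs_sum_sub_mul_accProb_le`). Summing over the coordinates
(`abs_prodExp_sub_prodExp_le`) shows that the average acceptance probabilities nearly agree, a
contradiction. The largest mass value grows only like `M ^ 2` while `M + 1` moments match, and this
quadratic trade-off determines the bound.

The masses are not normalised in advance: the reservoir absorbs the deficit, and acceptance is set
to `0` when their total is too large, an event controlled by an exponential moment.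

Since `l ≤ d`, the bound `l / log d` implies both parts as soon as `l` exceeds a multiple of `log d
^ 3`. In the second part the remaining `d` are bounded, and there one sample is enough. -/

namespace SampleTesting

/-! ### Moment matching by Lagrange weights -/

/-- Nodes `0, 1` followed by the shifted squares `β (1 + 4 j ^ 2)`. -/
noncomputable def node (β : ℝ) : ℕ → ℝ
  | 0 => 0
  | 1 => 1
  | (j + 2) => β * (1 + 4 * (j : ℝ) ^ 2)

/-- The Lagrange weights of the nodes `0, …, M + 2`, normalised to be `1` at the first node. -/
noncomputable def nodeWeight (β : ℝ) (M k : ℕ) : ℝ :=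
  (∏ i ∈ Finset.range (M + 3), if i = 0 then 1 else (node β 0 - node β i)) /
    ∏ i ∈ Finset.range (M + 3), if i = k then 1 else (node β k - node β i)

lemma node_strictMono {β : ℝ} (hβ : 2 ≤ β) : StrictMono (node β) := by
  refine strictMono_nat_of_lt_succ fun n => ?_
  match n with
  | 0 => simp [node]
  | 1 => simp [node]; linarith
  | (j + 2) =>
    simp only [node]
    push_cast
    have : (0 : ℝ) ≤ j := by positivity
    nlinarith

lemma prod_erase_eq_prod_ite (s : Finset ℕ) (k : ℕ) (f : ℕ → ℝ) :
    ∏ i ∈ s.erase k, f i = ∏ i ∈ s, if i = k then 1 else f i := by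
  rw [← Finset.filter_ne' s k, Finset.prod_filter]
  exact Finset.prod_congr rfl fun i _ => by by_cases h : i = k <;> simp [h]

/-- Up to a constant factor the sum is the divided difference of `X ^ r` at `M + 3` nodes, that is,
the coefficient of degree `M + 2` of its interpolant. This vanishes for smaller `r`. -/
lemma sum_nodeWeight_mul_pow {β : ℝ} (hβ : 2 ≤ β) (M r : ℕ) (hr : r ≤ M + 1) :
    ∑ k ∈ Finset.range (M + 3), nodeWeight β M k * node β k ^ r = 0 := by
  have h := Lagrange.coeff_eq_sum (s := Finset.range (M + 3)) (v := node β)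
    (node_strictMono hβ).injective.injOn (P := (Polynomial.X : Polynomial ℝ) ^ r)
    (by rw [Polynomial.degree_X_pow, Finset.card_range]; exact_mod_cast (by omega))
  rw [Finset.card_range, Polynomial.coeff_X_pow, if_neg (by omega)] at h
  simp only [prod_erase_eq_prod_ite, Polynomial.eval_pow, Polynomial.eval_X] at h
  simp only [nodeWeight, div_mul_eq_mul_div, mul_div_assoc]
  rw [← Finset.mul_sum, ← h, mul_zero]

lemma prod_node_sub_ne_zero {β : ℝ} (hβ : 2 ≤ β) (M k : ℕ) :
    ∏ i ∈ Finset.range (M + 3), (if i = k then 1 else (node β k - node β i)) ≠ 0 := by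
  refine Finset.prod_ne_zero_iff.2 fun i _ => ?_
  split_ifs with h
  · exact one_ne_zero
  · exact sub_ne_zero.2 fun e => h ((node_strictMono hβ).injective e).symm

lemma prod_range_add_three (f : ℕ → ℝ) (M : ℕ) :
    ∏ i ∈ Finset.range (M + 3), f i = f 0 * f 1 * ∏ i ∈ Finset.range (M + 1), f (i + 2) := by
  rw [Finset.prod_range_succ', Finset.prod_range_succ']
  ring

lemma nodeWeight_zero {β : ℝ} (hβ : 2 ≤ β) (M : ℕ) : nodeWeight β M 0 = 1 :=
  div_self (prod_node_sub_ne_zero hβ M 0)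

/-- Lagrange weights alternate in sign along the ordered nodes. Hence the node `1` does not
contribute to the positive part, whose nonzero nodes are then all at least `β`. -/
lemma nodeWeight_one_nonpos {β : ℝ} (hβ : 2 ≤ β) (M : ℕ) : nodeWeight β M 1 ≤ 0 := by
  have h : nodeWeight β M 1 = -∏ j ∈ Finset.range (M + 1), (-node β (j + 2) / (1 - node β (j + 2))) := by
    rw [nodeWeight, prod_range_add_three, prod_range_add_three, Finset.prod_div_distrib]
    simp [node]
    ring
  rw [h, neg_nonpos]
  refine Finset.prod_nonneg fun j _ => ?_
  have h1 : node β 1 < node β (j + 2) := node_strictMono hβ (by omega)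
  have h2 : node β 1 = 1 := rfl
  rw [h2] at h1
  exact div_nonneg_of_nonpos (by linarith) (by linarith)

/-- Each factor splits as `|j - i| (j + i)`. The factor 2 supplies half of the term `j + j` that is
missing at `i = j`; the other half, `j`, is compensated by the term `j + 0`. -/
lemma two_mul_prod_abs_sq_sub_sq (j : ℕ) (hj : 1 ≤ j) (M : ℕ) (hM : j ≤ M) :
    2 * ∏ i ∈ Finset.range (M + 1), (if i = j then 1 else |(j : ℝ) ^ 2 - (i : ℝ) ^ 2|)
      = ((M - j).factorial : ℝ) * ((M + j).factorial : ℝ) := by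
  induction M, hM using Nat.le_induction with
  | base =>
    obtain ⟨a, rfl⟩ : ∃ a, j = a + 1 := ⟨j - 1, by omega⟩
    rw [Finset.prod_range_succ, if_pos rfl, mul_one]
    have h1 : ∏ i ∈ Finset.range (a + 1), (if i = a + 1 then (1 : ℝ) else
        |((a + 1 : ℕ) : ℝ) ^ 2 - (i : ℝ) ^ 2|)
        = (∏ i ∈ Finset.range (a + 1), ((i : ℝ) + 1)) *
          ∏ i ∈ Finset.range (a + 1), (((a + 1 : ℕ) : ℝ) + i) := by
      rw [← Finset.prod_range_reflect (fun i => (i : ℝ) + 1), ← Finset.prod_mul_distrib]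
      refine Finset.prod_congr rfl fun i hi => ?_
      rw [Finset.mem_range] at hi
      rw [if_neg (by omega), Nat.sub_sub, Nat.cast_sub (by omega)]
      have hi' : (i : ℝ) + 1 ≤ a + 1 := by exact_mod_cast hi
      push_cast
      have hi0 : (0 : ℝ) ≤ i := by positivity
      rw [abs_of_nonneg (by nlinarith)]
      ring
    rw [h1]
    have h2 : ∏ i ∈ Finset.range (a + 1), ((i : ℝ) + 1) = ((a + 1).factorial : ℝ) := by
      rw [← Finset.prod_range_add_one_eq_factorial]; push_cast; rfl
    have h3 : (a.factorial : ℝ) * ∏ i ∈ Finset.range (a + 1), (((a + 1 : ℕ) : ℝ) + i)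
        = ((a + (a + 1)).factorial : ℝ) := by
      rw [← Nat.factorial_mul_ascFactorial a (a + 1), Nat.ascFactorial_eq_prod_range]
      push_cast; rfl
    have h4 : ((a + 1 + (a + 1)).factorial : ℝ) =
        (2 * (a + 1)) * ((a + (a + 1)).factorial : ℝ) := by
      rw [show a + 1 + (a + 1) = (a + (a + 1)) + 1 by ring, Nat.factorial_succ]
      push_cast; ring
    rw [h2, h4, ← h3, Nat.factorial_succ]
    simp
    ring
  | succ M hM ih =>
    rw [Finset.prod_range_succ, ← mul_assoc, ih, if_neg (by omega)]
    rw [show M + 1 - j = (M - j) + 1 by omega, show M + 1 + j = (M + j) + 1 by ring,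
      Nat.factorial_succ, Nat.factorial_succ]
    have hM' : (j : ℝ) ≤ M := by exact_mod_cast hM
    have hj0 : (0 : ℝ) ≤ j := by positivity
    push_cast
    rw [Nat.cast_sub hM, abs_of_nonpos (by nlinarith)]
    ring

/-- For `j ≥ 1` the quotient of the two sides is `choose (2 M) (M + j) / centralBinom M`, and the
central binomial coefficient is the largest in its row. -/
lemma factorial_sq_le_two_mul_prod (j M : ℕ) (hM : j ≤ M) :
    (M.factorial : ℝ) ^ 2 ≤
      2 * ∏ i ∈ Finset.range (M + 1), (if i = j then 1 else |(j : ℝ) ^ 2 - (i : ℝ) ^ 2|) := by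
  rcases Nat.eq_zero_or_pos j with rfl | hj
  · have : ∏ i ∈ Finset.range (M + 1), (if i = 0 then 1 else |((0 : ℕ) : ℝ) ^ 2 - (i : ℝ) ^ 2|)
        = (M.factorial : ℝ) ^ 2 := by
      rw [Finset.prod_range_succ', ← Finset.prod_range_add_one_eq_factorial]
      push_cast
      rw [mul_one, ← Finset.prod_pow]
      refine Finset.prod_congr rfl fun i _ => ?_
      rw [abs_of_nonpos (by nlinarith [sq_nonneg ((i : ℝ) + 1)])]
      ring
    rw [this]
    nlinarith [sq_nonneg (M.factorial : ℝ)]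
  · rw [two_mul_prod_abs_sq_sub_sq j hj M hM]
    have h1 := Nat.choose_le_centralBinom (M + j) M
    have h2 := Nat.choose_mul_factorial_mul_factorial (n := 2 * M) (k := M + j) (by omega)
    have h3 : Nat.centralBinom M * M.factorial * M.factorial = (2 * M).factorial := by
      have := Nat.choose_mul_factorial_mul_factorial (n := 2 * M) (k := M) (by omega)
      rwa [show 2 * M - M = M by omega] at this
    rw [show 2 * M - (M + j) = M - j by omega] at h2
    have h4 : M.factorial ^ 2 ≤ (M - j).factorial * (M + j).factorial := by
      have hp : 0 < Nat.centralBinom M := Nat.centralBinom_pos M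
      refine Nat.le_of_mul_le_mul_left ?_ hp
      calc Nat.centralBinom M * M.factorial ^ 2 = (2 * M).factorial := by rw [← h3]; ring
        _ = Nat.choose (2 * M) (M + j) * ((M - j).factorial * (M + j).factorial) := by
          rw [← h2]; ring
        _ ≤ _ := Nat.mul_le_mul_right _ h1
    exact_mod_cast h4

/-- The quotient by `4 ^ M * M! ^ 2` is the convergent product of the `1 + 1 / (4 i ^ 2)`; the
correction `1 / (M + 1)` makes the induction close. -/
lemma prod_one_add_four_mul_sq_le (M : ℕ) :
    ∏ i ∈ Finset.range (M + 1), (1 + 4 * (i : ℝ) ^ 2) ≤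
      (2 - 1 / (M + 1)) * (4 ^ M * (M.factorial : ℝ) ^ 2) := by
  induction M with
  | zero => norm_num
  | succ M ih =>
    rw [Finset.prod_range_succ, Nat.factorial_succ]
    refine (mul_le_mul_of_nonneg_right ih (by positivity)).trans ?_
    push_cast
    set x : ℝ := (M : ℝ) + 1
    have hx : 1 ≤ x := by simp [x]
    have h : (2 - 1 / x) * (1 + 4 * x ^ 2) ≤ (2 - 1 / (x + 1)) * (4 * x ^ 2) := by
      have e : (2 - 1 / (x + 1)) * (4 * x ^ 2) - (2 - 1 / x) * (1 + 4 * x ^ 2) =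
          (2 * x ^ 2 - x + 1) / (x * (x + 1)) := by field_simp; ring
      have : 0 ≤ (2 * x ^ 2 - x + 1) / (x * (x + 1)) := by
        apply div_nonneg <;> nlinarith
      linarith
    calc (2 - 1 / x) * (4 ^ M * (M.factorial : ℝ) ^ 2) * (1 + 4 * x ^ 2)
        = ((2 - 1 / x) * (1 + 4 * x ^ 2)) * (4 ^ M * (M.factorial : ℝ) ^ 2) := by ring
      _ ≤ ((2 - 1 / (x + 1)) * (4 * x ^ 2)) * (4 ^ M * (M.factorial : ℝ) ^ 2) := by gcongr
      _ = _ := by ring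

/-- The powers of `β` and `4` and the squared factorials cancel up to constants, leaving the factors
`t` and `t - 1` due to the nodes `0` and `1`. This quadratic decay in `t` is what keeps the mean of
the positive part bounded. -/
lemma abs_nodeWeight_le {β : ℝ} (hβ : 2 ≤ β) (M j : ℕ) (hj : j ≤ M) :
    |nodeWeight β M (j + 2)| ≤ 4 * β / (node β (j + 2) * (node β (j + 2) - 1)) := by
  set t := node β (j + 2) with ht
  have ht1 : 1 < t := node_strictMono hβ (show 1 < j + 2 by omega)
  set Q := ∏ i ∈ Finset.range (M + 1), (if i = j then 1 else |(j : ℝ) ^ 2 - (i : ℝ) ^ 2|) with hQ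
  have hQ1 := factorial_sq_le_two_mul_prod j M hj
  rw [← hQ] at hQ1
  have hfac : (0 : ℝ) < (M.factorial : ℝ) ^ 2 := by positivity
  have hQpos : 0 < Q := by linarith
  have hnum : |∏ i ∈ Finset.range (M + 3), (if i = 0 then 1 else (node β 0 - node β i))| =
      β ^ (M + 1) * ∏ i ∈ Finset.range (M + 1), (1 + 4 * (i : ℝ) ^ 2) := by
    rw [prod_range_add_three, abs_mul, Finset.abs_prod, ← Finset.card_range (M + 1),
      ← Finset.prod_const, Finset.card_range, ← Finset.prod_mul_distrib]
    simp only [node]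
    norm_num
    refine Finset.prod_congr rfl fun i _ => ?_
    rw [abs_of_nonneg (by positivity), abs_of_nonneg (by positivity)]
  have hden : |∏ i ∈ Finset.range (M + 3), (if i = j + 2 then 1 else (node β (j + 2) - node β i))| =
      t * (t - 1) * ((4 * β) ^ M * Q) := by
    have hconst : (4 * β) ^ M = ∏ i ∈ Finset.range (M + 1), (if i = j then 1 else 4 * β) := by
      rw [← prod_erase_eq_prod_ite, Finset.prod_const, Finset.card_erase_of_mem (by simp; omega)]
      simp
    rw [prod_range_add_three, abs_mul, Finset.abs_prod, hconst, hQ, ← Finset.prod_mul_distrib,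
      if_neg (by omega), if_neg (by omega)]
    congr 1
    · rw [← ht, show node β 0 = 0 from rfl, show node β 1 = 1 from rfl, sub_zero, abs_of_pos]
      · exact mul_pos (by linarith) (by linarith)
    · refine Finset.prod_congr rfl fun i _ => ?_
      by_cases h : i = j
      · simp [h]
      · rw [if_neg (by omega), if_neg h, if_neg h, ← abs_of_pos (show 0 < 4 * β by linarith),
          ← abs_mul]
        simp only [node]
        congr 1
        ring
  rw [nodeWeight, abs_div, hnum, hden]
  have hP := prod_one_add_four_mul_sq_le M
  have hP' : ∏ i ∈ Finset.range (M + 1), (1 + 4 * (i : ℝ) ^ 2) ≤ 4 * (4 ^ M * Q) := by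
    refine hP.trans ?_
    have : (2 - 1 / ((M : ℝ) + 1)) ≤ 2 := by
      have : 0 ≤ 1 / ((M : ℝ) + 1) := by positivity
      linarith
    calc _ ≤ 2 * (4 ^ M * (M.factorial : ℝ) ^ 2) := by gcongr
      _ ≤ 2 * (4 ^ M * (2 * Q)) := by gcongr
      _ = _ := by ring
  have hb : 0 < β := by linarith
  have htt : 0 < t * (t - 1) := mul_pos (by linarith) (by linarith)
  rw [div_le_div_iff₀ (by positivity) htt]
  calc _ ≤ β ^ (M + 1) * (4 * (4 ^ M * Q)) * (t * (t - 1)) := by gcongr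
    _ = _ := by rw [mul_pow]; ring

lemma sum_inv_one_add_four_mul_sq_le (M : ℕ) :
    ∑ j ∈ Finset.range (M + 1), 1 / (1 + 4 * (j : ℝ) ^ 2) ≤ 2 := by
  suffices h : ∑ j ∈ Finset.range (M + 1), 1 / (1 + 4 * (j : ℝ) ^ 2) ≤ 2 - 1 / ((M : ℝ) + 1) by
    have : 0 ≤ 1 / ((M : ℝ) + 1) := by positivity
    linarith
  induction M with
  | zero => norm_num
  | succ M ih =>
    rw [Finset.sum_range_succ]
    push_cast
    have hM : (0 : ℝ) ≤ M := by positivity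
    have e : 1 / ((M : ℝ) + 1) - 1 / (M + 1 + 1) = 1 / ((M + 1) * (M + 2)) := by
      field_simp; ring
    have : 1 / (1 + 4 * ((M : ℝ) + 1) ^ 2) ≤ 1 / ((M + 1) * (M + 2)) :=
      one_div_le_one_div_of_le (by positivity) (by nlinarith)
    linarith

/-- Two probability distributions on finitely many nonnegative reals whose moments agree up to
order `M + 1`. The second one does not charge `0`, the first one is concentrated at `0`. -/
theorem exists_moment_matching {β : ℝ} (hβ : 2 ≤ β) (M : ℕ) :
    ∃ y w w' : Fin (M + 3) → ℝ, (∀ k, 0 ≤ w k) ∧ (∀ k, 0 ≤ w' k) ∧ ∑ k, w k = 1 ∧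
      ∑ k, w' k = 1 ∧ (∀ r ≤ M + 1, ∑ k, w k * y k ^ r = ∑ k, w' k * y k ^ r) ∧
      (∀ k, y k = 0 ∨ 1 ≤ y k) ∧ (∀ k, y k ≤ β * (1 + 4 * (M : ℝ) ^ 2)) ∧
      (∀ k, y k = 0 → w' k = 0) ∧ (∑ k, w k * (if y k = 0 then 0 else 1) ≤ 16 / β) ∧
      ∑ k, w k * y k ≤ 16 := by
  have hβ0 : 0 < β := by linarith
  have hmono := node_strictMono hβ
  set g := nodeWeight β M
  set Z := ∑ k ∈ Finset.range (M + 3), max (g k) 0 with hZ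
  have hg0 : g 0 = 1 := nodeWeight_zero hβ M
  have hg1 : g 1 ≤ 0 := nodeWeight_one_nonpos hβ M
  have hZ1 : 1 ≤ Z := by
    have := Finset.single_le_sum (f := fun k => max (g k) 0) (fun k _ => le_max_right _ _)
      (show 0 ∈ Finset.range (M + 3) by simp)
    simpa [hg0] using this
  have hZ0 : 0 < Z := by linarith
  have hgsub : ∀ k, max (g k) 0 - max (-g k) 0 = g k := fun k => max_zero_sub_max_neg_zero_eq_self _
  have hmom : ∀ r ≤ M + 1, ∑ k ∈ Finset.range (M + 3), max (g k) 0 * node β k ^ r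
      = ∑ k ∈ Finset.range (M + 3), max (-g k) 0 * node β k ^ r := fun r hr => by
    rw [← sub_eq_zero, ← Finset.sum_sub_distrib]
    simp_rw [← sub_mul, hgsub]
    exact sum_nodeWeight_mul_pow hβ M r hr
  have hZ' : ∑ k ∈ Finset.range (M + 3), max (-g k) 0 = Z := by
    simpa using (hmom 0 (by omega)).symm
  have hnode0 : ∀ k, node β k = 0 → k = 0 := fun k hk => hmono.injective (by rw [hk]; rfl)
  have hbound : ∀ j ∈ Finset.range (M + 1),
      max (g (j + 2)) 0 * node β (j + 2) ≤ 8 * (1 / (1 + 4 * (j : ℝ) ^ 2)) := fun j hj => by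
    have hj' : j ≤ M := by simpa [Nat.lt_succ_iff] using hj
    have ht : node β (j + 2) = β * (1 + 4 * (j : ℝ) ^ 2) := rfl
    have ht2 : 2 ≤ node β (j + 2) := by
      rw [ht]; nlinarith [sq_nonneg (j : ℝ)]
    have h1 : max (g (j + 2)) 0 ≤ 4 * β / (node β (j + 2) * (node β (j + 2) - 1)) :=
      (max_le (le_abs_self _) (abs_nonneg _)).trans (abs_nodeWeight_le hβ M j hj')
    calc _ ≤ 4 * β / (node β (j + 2) * (node β (j + 2) - 1)) * node β (j + 2) := by gcongr
      _ = 4 * β / (node β (j + 2) - 1) := by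
        have : node β (j + 2) - 1 ≠ 0 := by linarith
        field_simp
      _ ≤ 4 * β / (node β (j + 2) / 2) := by
        apply div_le_div_of_nonneg_left <;> linarith
      _ = _ := by rw [ht]; field_simp; norm_num
  have hsum : ∑ j ∈ Finset.range (M + 1), max (g (j + 2)) 0 * node β (j + 2) ≤ 16 := by
    refine (Finset.sum_le_sum hbound).trans ?_
    rw [← Finset.mul_sum]
    linarith [sum_inv_one_add_four_mul_sq_le M]
  have hmean : ∑ k ∈ Finset.range (M + 3), max (g k) 0 * node β k ≤ 16 := by
    -- The nodes `0` and `1` drop out: one has value `0`, the other has no positive part.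
    rw [Finset.sum_range_succ', Finset.sum_range_succ', zero_add, max_eq_right hg1]
    simpa [node] using hsum
  have hsupp : ∑ k ∈ Finset.range (M + 3), max (g k) 0 * (if node β k = 0 then 0 else 1) ≤
      16 / β := by
    rw [Finset.sum_range_succ', Finset.sum_range_succ', zero_add, max_eq_right hg1,
      if_pos (show node β 0 = 0 from rfl), zero_mul, mul_zero, add_zero, add_zero, le_div_iff₀ hβ0,
      Finset.sum_mul]
    -- Markov's inequality: the remaining nodes are at least `β`.
    refine (Finset.sum_le_sum fun j _ => ?_).trans hsum
    have ht : β ≤ node β (j + 2) := by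
      rw [show node β (j + 2) = β * (1 + 4 * (j : ℝ) ^ 2) from rfl]
      nlinarith [mul_nonneg hβ0.le (sq_nonneg (j : ℝ))]
    have : node β (j + 2) ≠ 0 := by linarith
    rw [if_neg this, mul_one]
    gcongr
  have hdiv : ∀ {a b : ℝ}, 0 ≤ b → a ≤ b → a / Z ≤ b := fun hb hab =>
    (div_le_div_of_nonneg_right hab hZ0.le).trans (div_le_self hb hZ1)
  have hfin : ∀ f : ℕ → ℝ, ∑ k : Fin (M + 3), f k = ∑ k ∈ Finset.range (M + 3), f k :=
    fun f => Fin.sum_univ_eq_sum_range f _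
  refine ⟨fun k => node β k, fun k => max (g k) 0 / Z, fun k => max (-g k) 0 / Z,
    fun k => by positivity, fun k => by positivity, ?_, ?_, fun r hr => ?_, fun k => ?_,
    fun k => ?_, fun k hk => ?_, ?_, ?_⟩
  · rw [hfin (fun k => max (g k) 0 / Z), ← Finset.sum_div, div_self hZ0.ne']
  · rw [hfin (fun k => max (-g k) 0 / Z), ← Finset.sum_div, hZ', div_self hZ0.ne']
  · rw [hfin (fun k => max (g k) 0 / Z * node β k ^ r),
      hfin (fun k => max (-g k) 0 / Z * node β k ^ r)]
    simp_rw [div_mul_eq_mul_div]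
    rw [← Finset.sum_div, ← Finset.sum_div, hmom r hr]
  · rcases Nat.eq_zero_or_pos (k : ℕ) with h | h
    · left; simp only [h]; rfl
    · right; exact hmono.monotone (show 1 ≤ (k : ℕ) from h)
  · exact hmono.monotone (show (k : ℕ) ≤ M + 2 by omega)
  · simp only [hnode0 k hk, hg0]; norm_num
  · rw [hfin (fun k => max (g k) 0 / Z * (if node β k = 0 then 0 else 1))]
    simp_rw [div_mul_eq_mul_div]
    rw [← Finset.sum_div]
    exact hdiv (by positivity) hsupp
  · rw [hfin (fun k => max (g k) 0 / Z * node β k)]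
    simp_rw [div_mul_eq_mul_div]
    rw [← Finset.sum_div]
    exact hdiv (by positivity) hmean

/-! ### Product expectations and Lindeberg replacement -/

section ProductExpectation

variable {J : Type*} [Fintype J]

/-- The expectation of `F` under the `n`-fold product of the weights `w`. -/
noncomputable def prodExp (n : ℕ) (w : J → ℝ) (F : (Fin n → J) → ℝ) : ℝ :=
  ∑ σ : Fin n → J, (∏ i, w (σ i)) * F σ

lemma prodExp_succ (n : ℕ) (w : J → ℝ) (F : (Fin (n + 1) → J) → ℝ) :
    prodExp (n + 1) w F = ∑ k, w k * prodExp n w (fun σ => F (Fin.cons k σ)) := by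
  unfold prodExp
  rw [← (Fin.consEquiv fun _ => J).sum_comp, Fintype.sum_prod_type]
  refine Finset.sum_congr rfl fun k _ => ?_
  rw [Finset.mul_sum]
  refine Finset.sum_congr rfl fun σ _ => ?_
  simp [Fin.consEquiv, Fin.prod_univ_succ, mul_assoc]

lemma prodExp_mono {n : ℕ} {w : J → ℝ} (hw : ∀ k, 0 ≤ w k) {F G : (Fin n → J) → ℝ}
    (h : ∀ σ, (∀ i, w (σ i) ≠ 0) → F σ ≤ G σ) : prodExp n w F ≤ prodExp n w G := by
  refine Finset.sum_le_sum fun σ _ => ?_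
  by_cases hσ : ∀ i, w (σ i) ≠ 0
  · exact mul_le_mul_of_nonneg_left (h σ hσ) (Finset.prod_nonneg fun i _ => hw _)
  · push Not at hσ
    obtain ⟨i, hi⟩ := hσ
    rw [Finset.prod_eq_zero (Finset.mem_univ i) hi, zero_mul, zero_mul]

lemma prodExp_add (n : ℕ) (w : J → ℝ) (F G : (Fin n → J) → ℝ) :
    prodExp n w (fun σ => F σ + G σ) = prodExp n w F + prodExp n w G := by
  simp [prodExp, mul_add, Finset.sum_add_distrib]

lemma prodExp_mul_left (n : ℕ) (w : J → ℝ) (c : ℝ) (F : (Fin n → J) → ℝ) :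
    prodExp n w (fun σ => c * F σ) = c * prodExp n w F := by
  rw [prodExp, prodExp, Finset.mul_sum]
  exact Finset.sum_congr rfl fun σ _ => by ring

lemma prodExp_prod (n : ℕ) (w b : J → ℝ) :
    prodExp n w (fun σ => ∏ i, b (σ i)) = (∑ k, w k * b k) ^ n := by
  unfold prodExp
  simp_rw [← Finset.prod_mul_distrib]
  rw [← Fintype.prod_sum (fun (_ : Fin n) k => w k * b k)]
  simp

lemma prodExp_const {n : ℕ} {w : J → ℝ} (hw : ∑ k, w k = 1) (c : ℝ) :
    prodExp n w (fun _ => c) = c := by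
  have := prodExp_prod n w (fun _ => 1)
  simp only [Finset.prod_const_one, mul_one, hw, one_pow] at this
  have h := prodExp_mul_left n w c (fun _ => 1)
  simpa [this] using h

lemma prodExp_sum {n : ℕ} {w : J → ℝ} (hw : ∑ k, w k = 1) (b : J → ℝ) :
    prodExp n w (fun σ => ∑ i, b (σ i)) = n * ∑ k, w k * b k := by
  induction n with
  | zero => simp [prodExp]
  | succ n ih =>
    rw [prodExp_succ]
    simp only [Fin.sum_univ_succ, Fin.cons_zero, Fin.cons_succ]
    have h : ∀ k, prodExp n w (fun σ => b k + ∑ i, b (σ i)) = b k + n * ∑ k, w k * b k :=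
      fun k => by rw [prodExp_add, prodExp_const hw, ih]
    simp_rw [h, mul_add, Finset.sum_add_distrib, ← Finset.sum_mul, hw]
    push_cast
    ring

lemma abs_prodExp_le {n : ℕ} {w : J → ℝ} (hw : ∀ k, 0 ≤ w k) (F G : (Fin n → J) → ℝ)
    (h : ∀ σ, |F σ| ≤ G σ) : |prodExp n w F| ≤ prodExp n w G := by
  refine (Finset.abs_sum_le_sum_abs _ _).trans (Finset.sum_le_sum fun σ _ => ?_)
  rw [abs_mul, abs_of_nonneg (Finset.prod_nonneg fun i _ => hw _)]
  exact mul_le_mul_of_nonneg_left (h σ) (Finset.prod_nonneg fun i _ => hw _)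

/-- **Lindeberg replacement**: if changing the law of any single coordinate from `w` to `w'`
changes `F` by little, then so does changing the laws of all coordinates. -/
theorem abs_prodExp_sub_prodExp_le {w w' b : J → ℝ} {B η : ℝ} (hw : ∀ k, 0 ≤ w k)
    (hw' : ∀ k, 0 ≤ w' k) (hw1 : ∑ k, w k = 1) (hw'1 : ∑ k, w' k = 1) (hb : ∀ k, 0 ≤ b k)
    (hB : 1 ≤ B) (hwB : ∑ k, w k * b k ≤ B) (hw'B : ∑ k, w' k * b k ≤ B)
    (n : ℕ) (c : ℝ) (hc : 0 ≤ c) (F : (Fin n → J) → ℝ)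
    (hF : ∀ i σ, |∑ k, (w k - w' k) * F (Function.update σ i k)| ≤
      η + c * ∏ i', if i' = i then 1 else b (σ i')) :
    |prodExp n w F - prodExp n w' F| ≤ n * (η + c * B ^ n) := by
  induction n generalizing c with
  | zero => simp [prodExp]
  | succ n ih =>
    -- Change the last `n` coordinates while the first keeps the law `w`, then change the first.
    have hsplit : prodExp (n + 1) w F - prodExp (n + 1) w' F =
        ∑ k, w k * (prodExp n w (fun σ => F (Fin.cons k σ)) -
          prodExp n w' (fun σ => F (Fin.cons k σ))) +
        prodExp n w' (fun σ => ∑ k, (w k - w' k) * F (Fin.cons k σ)) := by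
      have h : prodExp n w' (fun σ => ∑ k, (w k - w' k) * F (Fin.cons k σ)) =
          ∑ k, (w k - w' k) * prodExp n w' (fun σ => F (Fin.cons k σ)) := by
        simp_rw [← prodExp_mul_left]
        simp only [prodExp, Finset.mul_sum]
        exact Finset.sum_comm
      rw [h, prodExp_succ, prodExp_succ, ← Finset.sum_add_distrib, ← Finset.sum_sub_distrib]
      exact Finset.sum_congr rfl fun k _ => by ring
    have h1 : ∀ k, |prodExp n w (fun σ => F (Fin.cons k σ)) -
        prodExp n w' (fun σ => F (Fin.cons k σ))| ≤ n * (η + c * b k * B ^ n) := fun k => by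
      -- Freezing the first coordinate at `k` moves its factor `b k` into the constant, which is why
      -- `c` is generalised.
      refine ih (c * b k) (mul_nonneg hc (hb k)) _ fun i σ => ?_
      have := hF i.succ (Fin.cons k σ)
      simp only [Fin.prod_univ_succ, Fin.cons_zero, Fin.cons_succ,
        Fin.succ_inj, if_neg (Fin.succ_ne_zero i).symm, ← mul_assoc] at this
      simpa only [Fin.cons_update] using this
    have h2 : |prodExp n w' (fun σ => ∑ k, (w k - w' k) * F (Fin.cons k σ))| ≤
        η + c * B ^ n := by
      refine (abs_prodExp_le hw' _ (fun σ => η + c * ∏ i, b (σ i)) fun σ => ?_).trans ?_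
      · rcases isEmpty_or_nonempty J with hJ | ⟨⟨k₀⟩⟩
        · simp at hw1
        · have := hF 0 (Fin.cons k₀ σ)
          simpa [Fin.prod_univ_succ, Fin.succ_ne_zero] using this
      · rw [prodExp_add, prodExp_const hw'1, prodExp_mul_left, prodExp_prod]
        gcongr
        exact Finset.sum_nonneg fun k _ => mul_nonneg (hw' k) (hb k)
    have h3 : |∑ k, w k * (prodExp n w (fun σ => F (Fin.cons k σ)) -
        prodExp n w' (fun σ => F (Fin.cons k σ)))| ≤ n * (η + c * B ^ (n + 1)) := by
      calc _ ≤ ∑ k, w k * (n * (η + c * b k * B ^ n)) := by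
            refine (Finset.abs_sum_le_sum_abs _ _).trans (Finset.sum_le_sum fun k _ => ?_)
            rw [abs_mul, abs_of_nonneg (hw k)]
            exact mul_le_mul_of_nonneg_left (h1 k) (hw k)
        _ = n * (η * ∑ k, w k + c * (∑ k, w k * b k) * B ^ n) := by
            simp only [Finset.mul_sum, Finset.sum_mul, ← Finset.sum_add_distrib]
            exact Finset.sum_congr rfl fun k _ => by ring
        _ ≤ n * (η * 1 + c * B * B ^ n) := by
            rw [hw1]
            gcongr
        _ = _ := by ring
    rw [hsplit]
    refine (abs_add_le _ _).trans ((add_le_add h3 h2).trans ?_)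
    have : c * B ^ n ≤ c * B ^ (n + 1) :=
      mul_le_mul_of_nonneg_left (pow_le_pow_right₀ hB (Nat.le_succ n)) hc
    push_cast
    linarith

end ProductExpectation

/-! ### The acceptance probability as a polynomial in a mass -/

section AcceptanceProbability

variable {ι : Type*} [Fintype ι] {m : ℕ}

/-- The probability that a test accepts on `m` independent samples from the weights `p`, where
`a x` is the probability that it accepts on `x`. -/
noncomputable def accProb (a : (Fin m → ι) → ℝ) (p : ι → ℝ) : ℝ :=
  ∑ x : Fin m → ι, a x * ∏ j, p (x j)

/-- The coefficients in the expansion of `v ↦ accProb a (q + v • e)`. -/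
noncomputable def accCoeff (a : (Fin m → ι) → ℝ) (q e : ι → ℝ) (s : Finset (Fin m)) : ℝ :=
  ∑ x : Fin m → ι, a x * ((∏ j ∈ s, e (x j)) * ∏ j ∈ Finset.univ \ s, q (x j))

lemma accProb_add_mul (a : (Fin m → ι) → ℝ) (q e : ι → ℝ) (v : ℝ) :
    accProb a (fun i => v * e i + q i) =
      ∑ s ∈ (Finset.univ : Finset (Fin m)).powerset, v ^ s.card * accCoeff a q e s := by
  simp only [accProb, accCoeff, Finset.prod_add, Finset.mul_sum]
  rw [Finset.sum_comm]
  refine Finset.sum_congr rfl fun s _ => Finset.sum_congr rfl fun x _ => ?_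
  rw [Finset.prod_mul_distrib, Finset.prod_const]
  ring

/-- Without `a` the sum factors over the samples, each sample in `s` contributing the `ℓ¹` norm of
`e` and each other sample that of `q`. The bound 2 on `e` fits a direction that moves mass from one
point to another. -/
lemma abs_accCoeff_le {a : (Fin m → ι) → ℝ} (ha : ∀ x, |a x| ≤ 1) {q e : ι → ℝ}
    (hq : ∑ i, |q i| ≤ 1) (he : ∑ i, |e i| ≤ 2) (s : Finset (Fin m)) :
    |accCoeff a q e s| ≤ 2 ^ s.card := by
  calc |accCoeff a q e s|
      ≤ ∑ x : Fin m → ι, ∏ j, (if j ∈ s then |e (x j)| else |q (x j)|) := by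
        refine (Finset.abs_sum_le_sum_abs _ _).trans (Finset.sum_le_sum fun x _ => ?_)
        rw [abs_mul, abs_mul, Finset.abs_prod, Finset.abs_prod, Finset.prod_ite]
        have e1 : Finset.univ.filter (fun j => j ∈ s) = s := by ext; simp
        have e2 : Finset.univ.filter (fun j => j ∉ s) = Finset.univ \ s := by ext; simp
        rw [e1, e2]
        exact mul_le_of_le_one_left (mul_nonneg (Finset.prod_nonneg fun _ _ => abs_nonneg _)
          (Finset.prod_nonneg fun _ _ => abs_nonneg _)) (ha x)
    _ = ∏ j : Fin m, ∑ i, (if j ∈ s then |e i| else |q i|) :=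
        (Fintype.prod_sum (fun (j : Fin m) i => if j ∈ s then |e i| else |q i|)).symm
    _ ≤ ∏ j : Fin m, (if j ∈ s then 2 else 1) := by
        refine Finset.prod_le_prod (fun j _ => Finset.sum_nonneg fun i _ => ?_) fun j _ => ?_
        · split_ifs <;> exact abs_nonneg _
        · split_ifs
          · exact he
          · exact hq
    _ = 2 ^ s.card := by
        rw [Finset.prod_ite, Finset.prod_const, Finset.prod_const_one, mul_one]
        congr 2
        ext; simp

lemma accProb_nonneg {a : (Fin m → ι) → ℝ} (ha : ∀ x, 0 ≤ a x) {p : ι → ℝ} (hp : ∀ i, 0 ≤ p i) :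
    0 ≤ accProb a p :=
  Finset.sum_nonneg fun x _ => mul_nonneg (ha x) (Finset.prod_nonneg fun _ _ => hp _)

lemma accProb_le_one {a : (Fin m → ι) → ℝ} (ha : ∀ x, a x ≤ 1) {p : ι → ℝ} (hp : ∀ i, 0 ≤ p i)
    (hp1 : ∑ i, p i = 1) : accProb a p ≤ 1 := by
  calc accProb a p ≤ ∑ x : Fin m → ι, ∏ j, p (x j) := Finset.sum_le_sum fun x _ =>
        mul_le_of_le_one_left (Finset.prod_nonneg fun _ _ => hp _) (ha x)
    _ = ∏ _j : Fin m, ∑ i, p i := (Fintype.prod_sum (fun (_ : Fin m) i => p i)).symm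
    _ = 1 := by simp [hp1]

/-- If the first moments of two distributions on `[0, v]` agree, then the acceptance probability
hardly distinguishes them. -/
theorem abs_sum_sub_mul_accProb_le {J : Type*} [Fintype J] {w w' V : J → ℝ} {v : ℝ} {N : ℕ}
    (hw : ∀ k, 0 ≤ w k) (hw' : ∀ k, 0 ≤ w' k) (hw1 : ∑ k, w k = 1) (hw'1 : ∑ k, w' k = 1)
    (hV : ∀ k, 0 ≤ V k) (hVv : ∀ k, V k ≤ v) (hv : 0 ≤ v)
    (hmom : ∀ r < N, ∑ k, w k * V k ^ r = ∑ k, w' k * V k ^ r)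
    {a : (Fin m → ι) → ℝ} (ha : ∀ x, |a x| ≤ 1) {q e : ι → ℝ}
    (hq : ∑ i, |q i| ≤ 1) (he : ∑ i, |e i| ≤ 2) :
    |∑ k, (w k - w' k) * accProb a (fun i => V k * e i + q i)| ≤
      (1 / 8) ^ N * (1 + 16 * v) ^ m := by
  have hmle : ∀ {u : J → ℝ}, (∀ k, 0 ≤ u k) → ∑ k, u k = 1 → ∀ r,
      0 ≤ ∑ k, u k * V k ^ r ∧ ∑ k, u k * V k ^ r ≤ v ^ r := fun {u} hu hu1 r => by
    refine ⟨Finset.sum_nonneg fun k _ => mul_nonneg (hu k) (pow_nonneg (hV k) r), ?_⟩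
    calc _ ≤ ∑ k, u k * v ^ r := Finset.sum_le_sum fun k _ =>
          mul_le_mul_of_nonneg_left (pow_le_pow_left₀ (hV k) (hVv k) r) (hu k)
      _ = v ^ r := by rw [← Finset.sum_mul, hu1, one_mul]
  have hexp : ∑ k, (w k - w' k) * accProb a (fun i => V k * e i + q i) =
      ∑ s ∈ (Finset.univ : Finset (Fin m)).powerset,
        (∑ k, w k * V k ^ s.card - ∑ k, w' k * V k ^ s.card) * accCoeff a q e s := by
    simp only [accProb_add_mul, Finset.mul_sum]
    rw [Finset.sum_comm]
    refine Finset.sum_congr rfl fun s _ => ?_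
    rw [← Finset.sum_sub_distrib, Finset.sum_mul]
    exact Finset.sum_congr rfl fun k _ => by ring
  rw [hexp]
  refine (Finset.abs_sum_le_sum_abs _ _).trans ?_
  calc _ ≤ ∑ s ∈ (Finset.univ : Finset (Fin m)).powerset, (1 / 8) ^ N * (16 * v) ^ s.card := by
        refine Finset.sum_le_sum fun s _ => ?_
        rcases lt_or_ge s.card N with h | h
        · rw [hmom _ h, sub_self, zero_mul, abs_zero]
          positivity
        · rw [abs_mul]
          have h1 : |∑ k, w k * V k ^ s.card - ∑ k, w' k * V k ^ s.card| ≤ v ^ s.card := by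
            have := hmle hw hw1 s.card
            have := hmle hw' hw'1 s.card
            rw [abs_le]
            constructor <;> linarith
          calc _ ≤ v ^ s.card * 2 ^ s.card := by
                gcongr
                exact abs_accCoeff_le ha hq he s
            -- Degrees below `N` have cancelled, so giving up a factor 8 per degree gains at least
            -- `8 ^ N`.
            _ = (1 / 8) ^ s.card * (16 * v) ^ s.card := by
                rw [← mul_pow, ← mul_pow]; congr 1; ring
            _ ≤ _ := by
                gcongr ?_ * _
                exact pow_le_pow_of_le_one (by norm_num) (by norm_num) h
    _ = (1 / 8) ^ N * (1 + 16 * v) ^ m := by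
        rw [← Finset.mul_sum]
        have := Finset.prod_add (fun _ : Fin m => 16 * v) (fun _ => 1) Finset.univ
        simp only [Finset.prod_const, Finset.card_univ, Fintype.card_fin, one_pow, mul_one] at this
        rw [← this, add_comm]

end AcceptanceProbability

/-! ### A labelling far from the class, by Sauer–Shelah -/

lemma sum_pow_card_univ (n : ℕ) (x : ℝ) :
    ∑ t : Finset (Fin n), x ^ t.card = (1 + x) ^ n := by
  have := Finset.prod_add (fun _ : Fin n => x) (fun _ => 1) Finset.univ
  simp only [Finset.prod_const, Finset.card_univ, Fintype.card_fin, one_pow, mul_one,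
    Finset.powerset_univ] at this
  rw [← this, add_comm]

/-- Counting with exponential weights: it bounds both the shattered sets and a Hamming ball without
binomial estimates. -/
lemma card_le_mul_one_add_pow {n : ℕ} (𝒯 : Finset (Finset (Fin n))) {x c : ℝ} (hx : 0 ≤ x)
    (hc : 0 ≤ c) (h : ∀ t ∈ 𝒯, 1 ≤ c * x ^ t.card) : (𝒯.card : ℝ) ≤ c * (1 + x) ^ n := by
  calc (𝒯.card : ℝ) = ∑ t ∈ 𝒯, (1 : ℝ) := by simp
    _ ≤ ∑ t ∈ 𝒯, c * x ^ t.card := Finset.sum_le_sum h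
    _ ≤ ∑ t : Finset (Fin n), c * x ^ t.card :=
        Finset.sum_le_sum_of_subset_of_nonneg (Finset.subset_univ _) fun _ _ _ => by positivity
    _ = _ := by rw [← Finset.mul_sum, sum_pow_card_univ]

open scoped symmDiff in
/-- A class of labellings of `n = 5 d - 1` points that shatters no set of more than `d` points does not
come within Hamming distance `d / 10` of every labelling. -/
theorem exists_labelling_far {d n : ℕ} (hd : 2 ≤ d) (hn : n + 1 = 5 * d) (G : Set (Fin n → Bool))
    (hG : ∀ T : Finset (Fin n),
      (∀ ℓ : Fin n → Bool, ∃ g ∈ G, ∀ i ∈ T, g i = ℓ i) → T.card ≤ d) :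
    ∃ ℓ : Fin n → Bool, ∀ g ∈ G,
      d < 10 * (Finset.univ.filter fun i => ℓ i ≠ g i).card := by
  classical
  by_contra! hcon
  set 𝒜 : Finset (Finset (Fin n)) :=
    Finset.univ.filter fun s => ∃ g ∈ G, s = Finset.univ.filter fun i => g i = true with h𝒜
  set ℬ : Finset (Finset (Fin n)) := Finset.univ.filter fun t => 10 * t.card ≤ d with hℬ
  -- If no labelling were far, each would be a pattern of `G` corrected on a small set.
  have hcover : (Finset.univ : Finset (Finset (Fin n))) ⊆
      (𝒜 ×ˢ ℬ).image fun st => st.1 ∆ st.2 := by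
    intro s _
    obtain ⟨g, hg, hgs⟩ := hcon fun i => decide (i ∈ s)
    rw [Finset.mem_image]
    refine ⟨(Finset.univ.filter fun i => g i = true,
      Finset.univ.filter fun i => decide (i ∈ s) ≠ g i), ?_, ?_⟩
    · simp only [Finset.mem_product, h𝒜, hℬ, Finset.mem_filter_univ]
      exact ⟨⟨g, hg, rfl⟩, hgs⟩
    · ext i
      by_cases hi : i ∈ s <;> by_cases hgi : g i = true <;>
        simp [Finset.mem_symmDiff, hi, hgi]
  have hcard : 2 ^ n ≤ 𝒜.card * ℬ.card := by
    have := (Finset.card_le_card hcover).trans Finset.card_image_le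
    simpa using this
  have hA : (𝒜.card : ℝ) ≤ 4 ^ d * (1 + 1 / 4) ^ n := by
    refine (Nat.cast_le.2 𝒜.card_le_card_shatterer).trans
      (card_le_mul_one_add_pow _ (by norm_num) (by positivity) fun t ht => ?_)
    have htd : t.card ≤ d := hG t fun ℓ => by
      rw [Finset.mem_shatterer] at ht
      obtain ⟨u, hu, htu⟩ := ht (Finset.filter_subset (fun i => ℓ i = true) t)
      simp only [h𝒜, Finset.mem_filter_univ] at hu
      obtain ⟨g, hg, rfl⟩ := hu
      refine ⟨g, hg, fun i hi => ?_⟩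
      have := congrArg (i ∈ ·) htu
      simp only [Finset.mem_inter, hi, Finset.mem_filter, Finset.mem_univ, true_and,
        eq_iff_iff] at this
      exact Bool.eq_iff_iff.2 this
    calc (1 : ℝ) = 4 ^ t.card * (1 / 4) ^ t.card := by rw [← mul_pow]; norm_num
      _ ≤ 4 ^ d * (1 / 4) ^ t.card := by gcongr; norm_num
  have hB : (ℬ.card : ℝ) ≤ (3 / 2) ^ d * (1 + (2 / 3) ^ 10) ^ n := by
    refine card_le_mul_one_add_pow _ (by norm_num) (by positivity) fun t ht => ?_
    simp only [hℬ, Finset.mem_filter_univ] at ht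
    calc (1 : ℝ) = (3 / 2) ^ (10 * t.card) * ((2 / 3) ^ 10) ^ t.card := by
          rw [← pow_mul, ← mul_pow]; norm_num
      _ ≤ (3 / 2) ^ d * ((2 / 3) ^ 10) ^ t.card := by gcongr; norm_num
  have h1 : (2 : ℝ) ^ n ≤ 4 ^ d * (1 + 1 / 4) ^ n * ((3 / 2) ^ d * (1 + (2 / 3) ^ 10) ^ n) := by
    calc (2 : ℝ) ^ n ≤ (𝒜.card : ℝ) * ℬ.card := by exact_mod_cast hcard
      _ ≤ _ := by gcongr
  -- Over `5 d` points there are `32 ^ d` labellings and fewer than `20 ^ d` are covered. The factor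
  -- `5 / 8` pays for having one point less, and `d ≥ 2` absorbs it.
  have h2 : (32 : ℝ) ^ d * (5 / 8) ≤ 20 ^ d := by
    have e32 : (32 : ℝ) ^ d = 2 ^ n * 2 := by
      rw [← pow_succ, hn, pow_mul]; norm_num
    have e20 : 4 ^ d * (1 + 1 / 4) ^ (n + 1) * ((3 / 2) ^ d * (1 + (2 / 3) ^ 10) ^ (n + 1)) ≤
        (20 : ℝ) ^ d := by
      rw [hn, pow_mul, pow_mul, ← mul_pow, ← mul_pow, ← mul_pow]
      exact pow_le_pow_left₀ (by norm_num) (by norm_num) d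
    calc (32 : ℝ) ^ d * (5 / 8) = 2 ^ n * (5 / 4) := by rw [e32]; ring
      _ ≤ 4 ^ d * (1 + 1 / 4) ^ n * ((3 / 2) ^ d * (1 + (2 / 3) ^ 10) ^ n) * (5 / 4) := by gcongr
      _ ≤ 4 ^ d * (1 + 1 / 4) ^ n * ((3 / 2) ^ d * (1 + (2 / 3) ^ 10) ^ n) *
          ((1 + 1 / 4) * (1 + (2 / 3) ^ 10)) := by gcongr; norm_num
      _ = 4 ^ d * (1 + 1 / 4) ^ (n + 1) * ((3 / 2) ^ d * (1 + (2 / 3) ^ 10) ^ (n + 1)) := by ring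
      _ ≤ _ := e20
  have h3 : (8 / 5 : ℝ) ^ d ≤ 8 / 5 := by
    have e : (32 : ℝ) ^ d = (8 / 5) ^ d * 20 ^ d := by rw [← mul_pow]; norm_num
    rw [e] at h2
    have : (0 : ℝ) < 20 ^ d := by positivity
    nlinarith
  have h4 : (8 / 5 : ℝ) ^ 2 ≤ (8 / 5) ^ d := pow_le_pow_right₀ (by norm_num) hd
  norm_num at h4
  linarith

/-! ### From testers to tests on finitely many points -/

/-- The law of a random point `pts i`, where `i` has the weights `p`. -/
theorem exists_discreteMeasure {X : Type u} [MeasurableSpace X] {ι : Type*} [Fintype ι]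
    (pts : ι → X) {p : ι → ℝ} (hp : ∀ i, 0 ≤ p i) (hp1 : ∑ i, p i = 1) :
    ∃ D : Measure X, IsProbabilityMeasure D ∧
      (∀ (m : ℕ) (φ : (Fin m → X) → ℝ≥0∞), AEMeasurable φ (Measure.pi fun _ : Fin m => D) →
        ∫⁻ x, φ x ∂(Measure.pi fun _ : Fin m => D) =
          ∑ x : Fin m → ι, φ (fun j => pts (x j)) * ENNReal.ofReal (∏ j, p (x j))) ∧
      ∀ s, MeasurableSet s → ∀ t : Finset ι, (∀ i ∈ t, pts i ∈ s) →
        ENNReal.ofReal (∑ i ∈ t, p i) ≤ D s := by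
  classical
  let _ : MeasurableSpace ι := ⊤
  set Q : Measure ι := ∑ i, ENNReal.ofReal (p i) • Measure.dirac i with hQ
  have hQs : ∀ i, Q {i} = ENNReal.ofReal (p i) := fun i => by
    simp [hQ, Measure.finsetSum_apply, Set.indicator, eq_comm]
  have hpts : Measurable pts := measurable_from_top
  have : IsProbabilityMeasure Q := ⟨by
    simp only [hQ, Measure.finsetSum_apply, Measure.smul_apply, measure_univ, smul_eq_mul, mul_one]
    rw [← ENNReal.ofReal_sum_of_nonneg fun i _ => hp i, hp1, ENNReal.ofReal_one]⟩
  have hD : IsProbabilityMeasure (Q.map pts) := Measure.isProbabilityMeasure_map hpts.aemeasurable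
  refine ⟨Q.map pts, hD, fun m φ hφ => ?_, fun s hs t ht => ?_⟩
  · have hmap : (Measure.pi fun _ : Fin m => Q.map pts) =
        (Measure.pi fun _ : Fin m => Q).map fun x j => pts (x j) :=
      (Measure.pi_map_pi fun _ => hpts.aemeasurable).symm
    rw [hmap] at hφ ⊢
    rw [lintegral_map' hφ (measurable_pi_lambda _ fun j => hpts.comp (measurable_pi_apply j)).aemeasurable, lintegral_fintype]
    refine Finset.sum_congr rfl fun x _ => ?_
    rw [Measure.pi_singleton, ENNReal.ofReal_prod_of_nonneg fun j _ => hp _]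
    simp_rw [hQs]
  · rw [Measure.map_apply hpts hs, ENNReal.ofReal_sum_of_nonneg fun i _ => hp i]
    simp_rw [← hQs]
    rw [sum_measure_singleton]
    exact measure_mono fun i hi => ht i hi

section Tester

variable {X : Type u} {m : ℕ} {A : (Fin m → X × Bool) → PMF Bool} {ι : Type*}

/-- The acceptance probability of a tester as a function of the indices of the sample points. -/
noncomputable def testValue (A : (Fin m → X × Bool) → PMF Bool) (pts : ι → X) (ℓ : ι → Bool)
    (b : Bool) (x : Fin m → ι) : ℝ :=
  (A (fun j => (pts (x j), ℓ (x j))) b).toReal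

lemma testValue_nonneg (pts : ι → X) (ℓ : ι → Bool) (b : Bool) (x : Fin m → ι) :
    0 ≤ testValue A pts ℓ b x := ENNReal.toReal_nonneg

lemma testValue_add (pts : ι → X) (ℓ : ι → Bool) (x : Fin m → ι) :
    testValue A pts ℓ true x + testValue A pts ℓ false x = 1 := by
  rw [testValue, testValue, ← ENNReal.toReal_add (PMF.apply_ne_top _ _) (PMF.apply_ne_top _ _)]
  have := (A fun j => (pts (x j), ℓ (x j))).tsum_coe
  rw [tsum_fintype, Fintype.sum_bool] at this
  rw [this, ENNReal.toReal_one]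

lemma testValue_le_one (pts : ι → X) (ℓ : ι → Bool) (b : Bool) (x : Fin m → ι) :
    testValue A pts ℓ b x ≤ 1 :=
  ENNReal.toReal_le_of_le_ofReal zero_le_one (by simpa using PMF.coe_le_one _ _)

variable [Fintype ι]

lemma accProb_eq_of_eq_on_support {a a' : (Fin m → ι) → ℝ} {p : ι → ℝ}
    (h : ∀ x : Fin m → ι, (∀ j, p (x j) ≠ 0) → a x = a' x) : accProb a p = accProb a' p := by
  refine Finset.sum_congr rfl fun x _ => ?_
  by_cases hx : ∀ j, p (x j) ≠ 0
  · rw [h x hx]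
  · push Not at hx
    obtain ⟨j, hj⟩ := hx
    rw [Finset.prod_eq_zero (Finset.mem_univ j) hj, mul_zero, mul_zero]

lemma two_thirds_le_accProb {pts : ι → X} {p : ι → ℝ} (hp : ∀ i, 0 ≤ p i) {f : X → Bool} {b : Bool}
    (h : 2 / 3 ≤ ∑ x : Fin m → ι, A (labelled f fun j => pts (x j)) b *
      ENNReal.ofReal (∏ j, p (x j))) :
    2 / 3 ≤ accProb (testValue A pts (fun i => f (pts i)) b) p := by
  have e : ∑ x : Fin m → ι, A (labelled f fun j => pts (x j)) b * ENNReal.ofReal (∏ j, p (x j)) =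
      ENNReal.ofReal (accProb (testValue A pts (fun i => f (pts i)) b) p) := by
    rw [accProb, ENNReal.ofReal_sum_of_nonneg fun x _ =>
      mul_nonneg (testValue_nonneg _ _ _ _) (Finset.prod_nonneg fun _ _ => hp _)]
    refine Finset.sum_congr rfl fun x _ => ?_
    rw [ENNReal.ofReal_mul (testValue_nonneg _ _ _ _), testValue,
      ENNReal.ofReal_toReal (PMF.apply_ne_top _ _)]
    rfl
  rw [e] at h
  have h23 : (2 / 3 : ℝ≥0∞) = ENNReal.ofReal (2 / 3) := by
    rw [ENNReal.ofReal_div_of_pos (by norm_num)]; simp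
  rw [h23] at h
  by_contra! hlt
  exact absurd h (not_le.2 ((ENNReal.ofReal_lt_ofReal_iff (by norm_num)).2 hlt))

variable [MeasurableSpace X] {H : Set (X → Bool)} {ε : ℝ}

theorem IsTester.two_thirds_le_accProb (hA : IsTester H ε m A) (hH : ∀ h ∈ H, Measurable h)
    {pts : ι → X} {p : ι → ℝ} (hp : ∀ i, 0 ≤ p i) (hp1 : ∑ i, p i = 1) {ℓ : ι → Bool}
    (h : ∃ f ∈ H, ∀ i, p i ≠ 0 → f (pts i) = ℓ i) :
    2 / 3 ≤ accProb (testValue A pts ℓ true) p := by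
  obtain ⟨f, hf, hfℓ⟩ := h
  obtain ⟨D, hD, hint, -⟩ := exists_discreteMeasure pts hp hp1
  have h1 := hA.accept D f (hH f hf) hf
  rw [hint m _ (hA.aemeasurable D f (hH f hf))] at h1
  refine (SampleTesting.two_thirds_le_accProb hp h1).trans_eq
    (accProb_eq_of_eq_on_support fun x hx => ?_)
  simp only [testValue, hfℓ _ (hx _)]

theorem IsTester.accProb_le_third (hA : IsTester H ε m A) (hH : ∀ h ∈ H, Measurable h)
    {pts : ι → X} {p : ι → ℝ} (hp : ∀ i, 0 ≤ p i) (hp1 : ∑ i, p i = 1) {f : X → Bool}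
    (hf : Measurable f) {τ : ℝ} (hε : 0 < ε) (hτ : ε < τ)
    (hfar : ∀ h ∈ H, ∃ t : Finset ι, (∀ i ∈ t, f (pts i) ≠ h (pts i)) ∧ τ ≤ ∑ i ∈ t, p i) :
    accProb (testValue A pts (fun i => f (pts i)) true) p ≤ 1 / 3 := by
  obtain ⟨D, hD, hint, hle⟩ := exists_discreteMeasure pts hp hp1
  have hdist : ENNReal.ofReal ε < distToClass D f H := by
    refine ((ENNReal.ofReal_lt_ofReal_iff (hε.trans hτ)).2 hτ).trans_le (le_iInf₂ fun h hh => ?_)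
    obtain ⟨t, ht, hτt⟩ := hfar h hh
    exact (ENNReal.ofReal_le_ofReal hτt).trans
      (hle _ (measurableSet_eq_fun hf (hH h hh)).compl t ht)
  have h1 := hA.reject D f hf hdist
  have hmeas : AEMeasurable (fun x => A (labelled f x) false) (Measure.pi fun _ : Fin m => D) := by
    -- Measurability is assumed for the acceptance probability only, and passes to its complement.
    have e : (fun x => A (labelled f x) false) = fun x => 1 - A (labelled f x) true := by
      funext x
      have := (A (labelled f x)).tsum_coe
      rw [tsum_fintype, Fintype.sum_bool] at this
      rw [← this, ENNReal.add_sub_cancel_left (PMF.apply_ne_top _ _)]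
    rw [e]
    exact (hA.aemeasurable D f hf).const_sub 1
  rw [hint m _ hmeas] at h1
  have h2 := SampleTesting.two_thirds_le_accProb hp h1
  have h3 : accProb (testValue A pts (fun i => f (pts i)) true) p +
      accProb (testValue A pts (fun i => f (pts i)) false) p = 1 := by
    rw [accProb, accProb, ← Finset.sum_add_distrib]
    simp_rw [← add_mul, testValue_add, one_mul]
    rw [← Fintype.prod_sum (fun (_ : Fin m) i => p i)]
    simp [hp1]
  linarith

end Tester

/-! ### Random masses: small and large supports are indistinguishable -/

/-- The point masses `u i / (160 n)`, with the remaining mass at the additional point `none`. -/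
noncomputable def masses {n : ℕ} (u : Fin n → ℝ) : Option (Fin n) → ℝ
  | none => 1 - (∑ i, u i) / (160 * n)
  | some i => u i / (160 * n)

lemma sum_masses {n : ℕ} (u : Fin n → ℝ) : ∑ x, masses u x = 1 := by
  simp [Fintype.sum_option, masses, Finset.sum_div]

lemma masses_nonneg {n : ℕ} {u : Fin n → ℝ} (hu : ∀ i, 0 ≤ u i) (h : ∑ i, u i ≤ 160 * n) (x) :
    0 ≤ masses u x := by
  rcases x with _ | i
  · exact sub_nonneg.2 (div_le_one_of_le₀ h (by positivity))
  · exact div_nonneg (hu i) (by positivity)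

lemma accProb_masses_mem {n m : ℕ} {a : (Fin m → Option (Fin n)) → ℝ} (ha0 : ∀ x, 0 ≤ a x)
    (ha1 : ∀ x, a x ≤ 1) {u : Fin n → ℝ} (hu : ∀ i, 0 ≤ u i) :
    0 ≤ (if ∑ i, u i ≤ 160 * n then accProb a (masses u) else 0) ∧
      (if ∑ i, u i ≤ 160 * n then accProb a (masses u) else 0) ≤ 1 := by
  split_ifs with h
  · exact ⟨accProb_nonneg ha0 (masses_nonneg hu h),
      accProb_le_one ha1 (masses_nonneg hu h) (sum_masses u)⟩
  · exact ⟨le_rfl, zero_le_one⟩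

/-- Uses `exp t ≤ 1 + 2 t` on `[0, 1]`. This exponential moment controls the event that the masses
overflow the truncation. -/
lemma sum_mul_exp_div_le {J : Type*} [Fintype J] {w y : J → ℝ} {Λ : ℝ} (hΛ : 0 < Λ)
    (hw : ∀ k, 0 ≤ w k) (hw1 : ∑ k, w k = 1) (hy : ∀ k, 0 ≤ y k) (hyΛ : ∀ k, y k ≤ Λ)
    (hmean : ∑ k, w k * y k ≤ 16) : ∑ k, w k * Real.exp (y k / Λ) ≤ 1 + 32 / Λ := by
  calc ∑ k, w k * Real.exp (y k / Λ) ≤ ∑ k, w k * (1 + 2 * (y k / Λ)) := by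
        refine Finset.sum_le_sum fun k _ => mul_le_mul_of_nonneg_left ?_ (hw k)
        have h0 : 0 ≤ y k / Λ := div_nonneg (hy k) hΛ.le
        have h1 : |y k / Λ| ≤ 1 := by
          rw [abs_of_nonneg h0]; exact div_le_one_of_le₀ (hyΛ k) hΛ.le
        have := (abs_le.1 (Real.abs_exp_sub_one_le h1)).2
        rw [abs_of_nonneg h0] at this
        linarith
    _ = ∑ k, w k + 2 / Λ * ∑ k, w k * y k := by
        rw [Finset.mul_sum, ← Finset.sum_add_distrib]
        exact Finset.sum_congr rfl fun k _ => by ring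
    _ ≤ 1 + 2 / Λ * 16 := by rw [hw1]; gcongr
    _ = _ := by ring

/-- The effect on the (truncated) acceptance probability of replacing the law of one of the masses
by another law with the same first moments. -/
lemma abs_sum_sub_mul_update_le {J : Type*} [Fintype J] {w w' y : J → ℝ} {Λ : ℝ} {n m N : ℕ}
    (hΛ : 0 < Λ) (hn : 0 < n)
    (hw : ∀ k, 0 ≤ w k) (hw' : ∀ k, 0 ≤ w' k) (hw1 : ∑ k, w k = 1) (hw'1 : ∑ k, w' k = 1)
    (hy : ∀ k, 0 ≤ y k) (hyΛ : ∀ k, y k ≤ Λ)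
    (hmom : ∀ r < N, ∑ k, w k * y k ^ r = ∑ k, w' k * y k ^ r)
    {a : (Fin m → Option (Fin n)) → ℝ} (ha0 : ∀ x, 0 ≤ a x) (ha1 : ∀ x, a x ≤ 1)
    {F : (Fin n → J) → ℝ}
    (hF : ∀ σ, F σ = if ∑ i, y (σ i) ≤ 160 * n then accProb a (masses fun i => y (σ i)) else 0)
    (i : Fin n) (σ : Fin n → J) :
    |∑ k, (w k - w' k) * F (Function.update σ i k)| ≤
      (1 / 8) ^ N * (1 + 16 * (Λ / (160 * n))) ^ m + Real.exp (1 - 160 * n / Λ) *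
        ∏ i', if i' = i then 1 else Real.exp (y (σ i') / Λ) := by
  have hn' : (0 : ℝ) < n := by exact_mod_cast hn
  set S := ∑ i', if i' = i then 0 else y (σ i') with hS
  have hS0 : ∀ i', 0 ≤ (if i' = i then 0 else y (σ i')) := fun i' => by
    split_ifs
    · exact le_rfl
    · exact hy _
  have hupd : ∀ k i', y (Function.update σ i k i') =
      (if i' = i then y k else 0) + (if i' = i then 0 else y (σ i')) := fun k i' => by
    by_cases h : i' = i
    · subst h; simp
    · simp [h]
  have hsum : ∀ k, ∑ i', y (Function.update σ i k i') = y k + S := fun k => by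
    simp_rw [hupd, Finset.sum_add_distrib, ← hS]
    simp
  have hprod : Real.exp (1 - 160 * n / Λ) *
      (∏ i', if i' = i then 1 else Real.exp (y (σ i') / Λ)) =
      Real.exp ((S + Λ - 160 * n) / Λ) := by
    have : ∀ i', (if i' = i then 1 else Real.exp (y (σ i') / Λ)) =
        Real.exp ((if i' = i then 0 else y (σ i')) / Λ) := fun i' => by
      split_ifs <;> simp
    simp_rw [this]
    rw [← Real.exp_sum, ← Finset.sum_div, ← Real.exp_add, ← hS]
    congr 1
    field_simp
    ring
  rw [hprod]
  -- Either even the largest value fits, so the truncation is inactive for every `k` and moments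
  -- cancel; or the exponential term is at least `1` and the trivial bound suffices.
  rcases le_or_gt (S + Λ) (160 * n) with h | h
  · refine le_add_of_le_of_nonneg ?_ (Real.exp_pos _).le
    set q := masses fun i' => if i' = i then 0 else y (σ i') with hq
    -- Raising the mass at `i` takes it from the reservoir, so the direction `e` has `ℓ¹` norm 2.
    set e : Option (Fin n) → ℝ := fun x => x.elim (-1) fun i' => if i' = i then 1 else 0 with he
    have hval : ∀ k, F (Function.update σ i k) =
        accProb a (fun x => y k / (160 * n) * e x + q x) := fun k => by
      rw [hF, if_pos (by rw [hsum]; linarith [hyΛ k])]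
      congr 1
      funext x
      rcases x with _ | i'
      · simp only [masses, hsum, he, hq, Option.elim_none, ← hS]
        ring
      · simp only [masses, hupd, he, hq, Option.elim_some]
        split_ifs <;> ring
    simp_rw [hval]
    have hq1 : ∑ x, |q x| ≤ 1 := by
      have hqn := masses_nonneg hS0 (show ∑ i', _ ≤ _ by rw [← hS]; linarith)
      rw [Finset.sum_congr rfl fun x _ => abs_of_nonneg (hqn x), sum_masses]
    have he2 : ∑ x, |e x| ≤ 2 := by
      rw [Fintype.sum_option]
      simp only [he, Option.elim_none, Option.elim_some, abs_neg, abs_one]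
      have : ∀ i', |if i' = i then (1 : ℝ) else 0| = if i' = i then 1 else 0 := fun i' => by
        split_ifs <;> simp
      simp_rw [this]
      simp
      norm_num
    refine abs_sum_sub_mul_accProb_le hw hw' hw1 hw'1 (fun k => div_nonneg (hy k) (by positivity))
      (fun k => div_le_div_of_nonneg_right (hyΛ k) (by positivity)) (by positivity)
      (fun r hr => ?_) (fun x => abs_le.2 ⟨by linarith [ha0 x], ha1 x⟩) hq1 he2
    simp_rw [div_pow, ← mul_div_assoc]
    rw [← Finset.sum_div, ← Finset.sum_div, hmom r hr]
  · have h1 : 1 ≤ Real.exp ((S + Λ - 160 * n) / Λ) :=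
      Real.one_le_exp (div_nonneg (by linarith) hΛ.le)
    have hb : ∀ {v : J → ℝ}, (∀ k, 0 ≤ v k) → ∑ k, v k = 1 →
        0 ≤ ∑ k, v k * F (Function.update σ i k) ∧ ∑ k, v k * F (Function.update σ i k) ≤ 1 := by
      intro v hv hv1
      have hFk : ∀ k, 0 ≤ F (Function.update σ i k) ∧ F (Function.update σ i k) ≤ 1 := fun k => by
        rw [hF]; exact accProb_masses_mem ha0 ha1 fun i' => hy _
      refine ⟨Finset.sum_nonneg fun k _ => mul_nonneg (hv k) (hFk k).1, ?_⟩
      rw [← hv1]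
      exact Finset.sum_le_sum fun k _ => mul_le_of_le_one_right (hv k) (hFk k).2
    have h2 : |∑ k, (w k - w' k) * F (Function.update σ i k)| ≤ 1 := by
      simp_rw [sub_mul]
      rw [Finset.sum_sub_distrib, abs_le]
      have := hb hw hw1
      have := hb hw' hw'1
      constructor <;> linarith
    have h3 : 0 ≤ (1 / 8 : ℝ) ^ N * (1 + 16 * (Λ / (160 * n))) ^ m := by positivity
    linarith

/-- No test with few samples tells small supports from distributions with all masses large. -/
theorem not_distinguishes_support {n l m M : ℕ} {a : (Fin m → Option (Fin n)) → ℝ}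
    (ha0 : ∀ x, 0 ≤ a x) (ha1 : ∀ x, a x ≤ 1) (hl : 1 ≤ l) (hln : l ≤ n)
    (hM : n * Real.exp (-(M + 2)) ≤ 1 / 20)
    (hlM : 2 * (1 + 4 * (M : ℝ) ^ 2) * (M + 3) ≤ l)
    (hm : 16 * m * (1 + 4 * (M : ℝ) ^ 2) ≤ l * (M + 2))
    (hyes : ∀ p : Option (Fin n) → ℝ, (∀ x, 0 ≤ p x) → ∑ x, p x = 1 →
      (Finset.univ.filter fun x => p x ≠ 0).card ≤ l → 2 / 3 ≤ accProb a p)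
    (hno : ∀ p : Option (Fin n) → ℝ, (∀ x, 0 ≤ p x) → ∑ x, p x = 1 →
      (∀ i, 1 / (160 * (n : ℝ)) ≤ p (some i)) → accProb a p ≤ 1 / 3) : False := by
  have hn : 0 < n := by omega
  have hn' : (0 : ℝ) < n := by exact_mod_cast hn
  have hl' : (0 : ℝ) < l := by exact_mod_cast hl
  have hln' : (l : ℝ) ≤ n := by exact_mod_cast hln
  -- With this `β` the expected number of nonzero masses under `w` is at most `16 n / β = l / 10`.
  set β : ℝ := 160 * n / l with hβ
  have hβ2 : 2 ≤ β := by rw [hβ, le_div_iff₀ hl']; linarith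
  have hβ0 : 0 < β := by linarith
  obtain ⟨y, w, w', hw, hw', hw1, hw'1, hmom, hy01, hyΛ, hyw', hsupp, hmean⟩ :=
    exists_moment_matching hβ2 M
  set Λ := β * (1 + 4 * (M : ℝ) ^ 2) with hΛ
  have hΛ0 : 0 < Λ := by positivity
  have hy : ∀ k, 0 ≤ y k := fun k => by rcases hy01 k with h | h <;> linarith
  have hmean' : ∑ k, w' k * y k ≤ 16 := by
    have := hmom 1 (by omega)
    simp only [pow_one] at this
    rwa [← this]
  set F : (Fin n → Fin (M + 3)) → ℝ := fun σ =>
    if ∑ i, y (σ i) ≤ 160 * n then accProb a (masses fun i => y (σ i)) else 0 with hF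
  have hlind := abs_prodExp_sub_prodExp_le hw hw' hw1 hw'1
    (b := fun k => Real.exp (y k / Λ)) (fun k => (Real.exp_pos _).le)
    (show 1 ≤ 1 + 32 / Λ by have : 0 ≤ 32 / Λ := by positivity
                            linarith)
    (sum_mul_exp_div_le hΛ0 hw hw1 hy hyΛ hmean) (sum_mul_exp_div_le hΛ0 hw' hw'1 hy hyΛ hmean')
    n (Real.exp (1 - 160 * n / Λ)) (Real.exp_pos _).le F
    (abs_sum_sub_mul_update_le (N := M + 2) hΛ0 hn hw hw' hw1 hw'1 hy hyΛ
      (fun r hr => hmom r (by omega)) ha0 ha1 fun σ => rfl)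
  have hη : (1 / 8) ^ (M + 2) * (1 + 16 * (Λ / (160 * n))) ^ m ≤ Real.exp (-(M + 2)) := by
    have h8 : (1 / 8 : ℝ) ≤ Real.exp (-2) := by
      rw [Real.exp_neg, one_div]
      refine inv_anti₀ (Real.exp_pos _) ?_
      have : Real.exp 2 = Real.exp 1 * Real.exp 1 := by rw [← Real.exp_add]; norm_num
      nlinarith [Real.exp_one_lt_d9, Real.exp_pos 1]
    have hv : Λ / (160 * n) = (1 + 4 * (M : ℝ) ^ 2) / l := by
      rw [hΛ, hβ]; field_simp
    have h1 : (1 + 16 * (Λ / (160 * n))) ^ m ≤ Real.exp (M + 2) := by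
      calc _ ≤ Real.exp (16 * (Λ / (160 * n))) ^ m := by
            gcongr
            linarith [Real.add_one_le_exp (16 * (Λ / (160 * (n : ℝ))))]
        _ = Real.exp (m * (16 * (Λ / (160 * n)))) := (Real.exp_nat_mul _ _).symm
        _ ≤ _ := by
            rw [Real.exp_le_exp, hv, ← mul_div_assoc, ← mul_div_assoc, div_le_iff₀ hl']
            linarith
    calc _ ≤ Real.exp (-2) ^ (M + 2) * Real.exp (M + 2) := by gcongr
      _ = _ := by
        rw [← Real.exp_nat_mul, ← Real.exp_add]
        congr 1
        push_cast
        ring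
  have hc : Real.exp (1 - 160 * n / Λ) * (1 + 32 / Λ) ^ n ≤ Real.exp (-(M + 2)) := by
    have hnΛ : 2 * (M + 3) ≤ 160 * (n / Λ) := by
      have : 160 * ((n : ℝ) / Λ) = l / (1 + 4 * (M : ℝ) ^ 2) := by rw [hΛ, hβ]; field_simp
      rw [this, le_div_iff₀ (by positivity)]
      linarith
    calc _ ≤ Real.exp (1 - 160 * n / Λ) * Real.exp (32 / Λ) ^ n := by
          gcongr
          linarith [Real.add_one_le_exp (32 / Λ)]
      _ = Real.exp (1 - 128 * (n / Λ)) := by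
          rw [← Real.exp_nat_mul, ← Real.exp_add]
          congr 1
          ring
      _ ≤ _ := by
          rw [Real.exp_le_exp]
          have : (0 : ℝ) ≤ M := by positivity
          linarith
  have hdiff : |prodExp n w F - prodExp n w' F| ≤ 1 / 10 := by
    refine hlind.trans ?_
    calc _ ≤ n * (Real.exp (-(M + 2)) + Real.exp (-(M + 2))) := by gcongr
      _ ≤ _ := by linarith
  have hlow : 2 / 3 * (1 - 1 / 10 - 1 / 10) ≤ prodExp n w F := by
    set s : Fin (M + 3) → ℝ := fun k => if y k = 0 then 0 else 1 with hs
    -- A linear minorant of `F` that encodes two Markov bounds: too many nonzero masses or too large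
    -- a total each cost at most `1 / 10` on average.
    have hG : ∀ σ : Fin n → Fin (M + 3),
        2 / 3 + (-(2 / 3) / l * ∑ i, s (σ i) + -(2 / 3) / (160 * n) * ∑ i, y (σ i)) ≤ F σ := by
      intro σ
      have hs0 : 0 ≤ ∑ i, s (σ i) := Finset.sum_nonneg fun i _ => by
        simp only [hs]; split_ifs <;> norm_num
      have hy0 : 0 ≤ ∑ i, y (σ i) := Finset.sum_nonneg fun i _ => hy _
      have e : 2 / 3 + (-(2 / 3) / l * ∑ i, s (σ i) + -(2 / 3) / (160 * n) * ∑ i, y (σ i)) =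
          2 / 3 * (1 - (∑ i, s (σ i)) / l - (∑ i, y (σ i)) / (160 * n)) := by ring
      have hA : 0 ≤ (∑ i, s (σ i)) / l := by positivity
      have hB : 0 ≤ (∑ i, y (σ i)) / (160 * n) := by positivity
      rw [e]
      by_cases h1 : ∑ i, y (σ i) ≤ 160 * n
      -- Strict inequality leaves room for `none` in a support of size `l`.
      · rcases lt_or_ge (∑ i, s (σ i)) l with h2 | h2
        · have : 2 / 3 ≤ F σ := by
            simp only [hF, if_pos h1]
            refine hyes _ (masses_nonneg (fun i => hy _) h1) (sum_masses _) ?_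
            have hcard : (∑ i, s (σ i)) =
                ((Finset.univ.filter fun i : Fin n => y (σ i) ≠ 0).card : ℝ) := by
              rw [Finset.card_filter]
              push_cast
              refine Finset.sum_congr rfl fun i _ => ?_
              by_cases hi : y (σ i) = 0 <;> simp [hs, hi]
            rw [hcard, Nat.cast_lt] at h2
            have hsub : (Finset.univ.filter fun x => masses (fun i => y (σ i)) x ≠ 0) ⊆
                insert none ((Finset.univ.filter fun i : Fin n => y (σ i) ≠ 0).image some) := by
              intro x hx
              rcases x with _ | i
              · exact Finset.mem_insert_self _ _
              · refine Finset.mem_insert_of_mem (Finset.mem_image_of_mem _ ?_)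
                simp only [Finset.mem_filter_univ, masses] at hx ⊢
                exact fun h0 => hx (by rw [h0, zero_div])
            refine (Finset.card_le_card hsub).trans ((Finset.card_insert_le _ _).trans ?_)
            exact (Nat.succ_le_succ Finset.card_image_le).trans h2
          linarith
        · have h3 : 1 ≤ (∑ i, s (σ i)) / l := by rwa [le_div_iff₀ hl', one_mul]
          have := (accProb_masses_mem ha0 ha1 (u := fun i => y (σ i)) fun i => hy _).1
          have : 0 ≤ F σ := this
          linarith
      · have h3 : 1 ≤ (∑ i, y (σ i)) / (160 * n) := by
          rw [le_div_iff₀ (by positivity), one_mul]; linarith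
        simp only [hF, if_neg h1]
        linarith
    refine le_trans ?_ (prodExp_mono hw fun σ _ => hG σ)
    rw [prodExp_add, prodExp_const hw1, prodExp_add, prodExp_mul_left, prodExp_mul_left,
      prodExp_sum hw1, prodExp_sum hw1]
    have h1 : (1 : ℝ) / l * (n * ∑ k, w k * s k) ≤ 1 / 10 := by
      calc _ ≤ (1 : ℝ) / l * (n * (16 / β)) := by gcongr
        _ = _ := by rw [hβ]; field_simp; norm_num
    have h2 : (1 : ℝ) / (160 * n) * (n * ∑ k, w k * y k) ≤ 1 / 10 := by
      calc _ ≤ (1 : ℝ) / (160 * n) * (n * 16) := by gcongr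
        _ = _ := by field_simp; norm_num
    have e : 2 / 3 + (-(2 / 3) / (l : ℝ) * (n * ∑ k, w k * s k) +
        -(2 / 3) / (160 * n) * (n * ∑ k, w k * y k)) =
        2 / 3 * (1 - (1 : ℝ) / l * (n * ∑ k, w k * s k) -
          (1 : ℝ) / (160 * n) * (n * ∑ k, w k * y k)) := by ring
    rw [e]
    linarith
  have hhigh : prodExp n w' F ≤ 1 / 3 := by
    rw [← prodExp_const (n := n) hw'1 (1 / 3)]
    refine prodExp_mono hw' fun σ hσ => ?_
    simp only [hF]
    split_ifs with h
    · refine hno _ (masses_nonneg (fun i => hy _) h) (sum_masses _) fun i => ?_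
      have : 1 ≤ y (σ i) := (hy01 _).resolve_left fun h0 => hσ i (hyw' _ h0)
      exact div_le_div_of_nonneg_right this (by positivity)
    · norm_num
  have := (abs_le.1 hdiff).2
  linarith

/-! ### VC and lower VC dimension -/

section Dimension

variable {X : Type u} {H : Set (X → Bool)} {S T : Set X} {d l k : ℕ}

lemma Shatters.mono {T' : Set X} (h : Shatters H T) (hT : T' ⊆ T) : Shatters H T' := by
  classical
  intro ℓ
  obtain ⟨f, hf, hfℓ⟩ := h fun x => if hx : (x : X) ∈ T' then ℓ ⟨x, hx⟩ else false
  exact ⟨f, hf, fun x => by simpa using hfℓ ⟨x, hT x.2⟩⟩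

lemma Shatters.card_le_of_vcDim_eq (h : Shatters H T) (hTS : T ⊆ S) (hd : vcDim H S = d)
    (hk : T.encard = k) : k ≤ d := by
  have : (k : ℕ∞) ≤ vcDim H S :=
    le_iSup₂_of_le (f := fun (k : ℕ) _ => (k : ℕ∞)) k ⟨T, hTS, hk, h⟩ le_rfl
  rw [hd] at this
  exact_mod_cast this

/-- If only smaller sizes qualified, the supremum would be at most `l - 1`. The value `0` is
excluded because it is also the supremum of the empty set. -/
lemma exists_le_of_lvcDim_eq (hl : lvcDim H S = l) (hl1 : 1 ≤ l) :
    ∃ k, l ≤ k ∧ (k : ℕ∞) ≤ S.encard ∧ ∀ T ⊆ S, T.encard = k → Shatters H T := by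
  by_contra! hcon
  have : lvcDim H S ≤ ((l - 1 : ℕ) : ℕ∞) := by
    refine iSup₂_le fun k hk => ?_
    have : k < l := by
      by_contra! hle
      obtain ⟨T, hT, hTk, hns⟩ := hcon k hle hk.1
      exact hns (hk.2 T hT hTk)
    exact_mod_cast (by omega)
  rw [hl, Nat.cast_le] at this
  omega

lemma shatters_of_encard_le_lvcDim (hl : lvcDim H S = l) (hl1 : 1 ≤ l) (hTS : T ⊆ S)
    (hT : T.encard ≤ l) : Shatters H T := by
  obtain ⟨k, hlk, hkS, hk⟩ := exists_le_of_lvcDim_eq hl hl1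
  obtain ⟨T', hTT', hT'S, hT'⟩ := Set.exists_superset_subset_encard_eq hTS
    (hT.trans (Nat.cast_le.2 hlk)) hkS
  exact (hk T' hT'S hT').mono hTT'

lemma lvcDim_le_vcDim (hd : vcDim H S = d) (hl : lvcDim H S = l) (hl1 : 1 ≤ l) : l ≤ d := by
  obtain ⟨k, hlk, hkS, hk⟩ := exists_le_of_lvcDim_eq hl hl1
  obtain ⟨T, hTS, hT⟩ := Set.exists_subset_encard_eq hkS
  exact hlk.trans ((hk T hTS hT).card_le_of_vcDim_eq hTS hd hT)

lemma exists_mem_eq_of_shatters_image {ι : Type*} {pts : ι → X} (hpts : Function.Injective pts)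
    {s : Set ι} (h : Shatters H (pts '' s)) (ℓ : ι → Bool) : ∃ f ∈ H, ∀ i ∈ s, f (pts i) = ℓ i := by
  obtain ⟨f, hf, hfℓ⟩ := h fun x => Function.extend pts ℓ (fun _ => false) x
  refine ⟨f, hf, fun i hi => ?_⟩
  rw [hfℓ ⟨pts i, Set.mem_image_of_mem _ hi⟩, hpts.extend_apply]

lemma exists_injective_points {n : ℕ} (h : ((n + 1 : ℕ) : ℕ∞) ≤ S.encard) :
    ∃ pts : Option (Fin n) → X, Function.Injective pts ∧ ∀ i, pts i ∈ S := by
  obtain ⟨T, hTS, hT⟩ := Set.exists_subset_encard_eq h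
  have hfin : T.Finite := Set.finite_of_encard_eq_coe hT
  have : Finite T := hfin
  have hcard : Nat.card (Option (Fin n)) = Nat.card T := by
    rw [Nat.card_coe_set_eq, Set.ncard, hT, ENat.toNat_natCast]
    simp
  obtain ⟨e⟩ := (Finite.card_eq (α := Option (Fin n)) (β := T)).1 hcard
  refine ⟨fun i => (e i : X), ?_, fun i => hTS (Subtype.coe_prop _)⟩
  exact Subtype.coe_injective.comp (Equiv.injective _)

/-- A measurable class that shatters all pairs from a finite set of points separates these points
by measurable sets, so that every labelling of them extends to a measurable function. -/
lemma exists_measurable_extension [MeasurableSpace X] {ι : Type*} [Finite ι]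
    (hH : ∀ h ∈ H, Measurable h) {pts : ι → X}
    (hpair : ∀ i j, i ≠ j → ∃ h ∈ H, h (pts i) = true ∧ h (pts j) = false) (ℓ : ι → Bool) :
    ∃ f : X → Bool, Measurable f ∧ ∀ i, f (pts i) = ℓ i := by
  classical
  choose! g hgH hgi hgj using hpair
  set E : Set X := ⋃ i ∈ {i | ℓ i = true}, ⋂ j ∈ {j | i ≠ j}, {x | g i j x = true} with hE
  have hEm : MeasurableSet E := by
    refine MeasurableSet.biUnion (Set.to_countable _) fun i _ =>
      MeasurableSet.biInter (Set.to_countable _) fun j hj => ?_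
    exact hH _ (hgH i j hj) (measurableSet_singleton true)
  have hmem : ∀ i, pts i ∈ E ↔ ℓ i = true := fun i => by
    simp only [hE, Set.mem_iUnion, Set.mem_iInter, Set.mem_ofPred_eq, exists_prop]
    constructor
    · rintro ⟨i', hi', h⟩
      by_contra hne
      have hii : i' ≠ i := fun e => hne (e ▸ hi')
      simpa [hgj i' i hii] using h i hii
    · exact fun hi => ⟨i, hi, fun j hj => hgi i j hj⟩
  refine ⟨fun x => decide (x ∈ E), ?_, fun i => ?_⟩
  · refine measurable_to_bool ?_
    have : (fun x => decide (x ∈ E)) ⁻¹' {true} = E := by ext; simp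
    rwa [this]
  · by_cases h : ℓ i = true
    · simp [hmem, h]
    · simp [hmem, h]

end Dimension

/-! ### The lower bound for testers -/

section LowerBound

variable {X : Type u} [MeasurableSpace X] {H : Set (X → Bool)} {S : Set X} {d l n m : ℕ} {ε : ℝ}
  {A : (Fin m → X × Bool) → PMF Bool}

/-- A tester yields a test, defined on finitely many points, that accepts all distributions of
support at most `l` and rejects the distributions without small masses. -/
theorem IsTester.exists_support_test (hA : IsTester H ε m A) (hH : ∀ h ∈ H, Measurable h)
    (hd : vcDim H S = d) (hl : lvcDim H S = l) (hl2 : 2 ≤ l) (hS : 5 * (d : ℕ∞) ≤ S.encard)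
    (hn : n + 1 = 5 * d) (hε0 : 0 < ε) (hε : ε < 1 / 8000) :
    ∃ a : (Fin m → Option (Fin n)) → ℝ, (∀ x, 0 ≤ a x) ∧ (∀ x, a x ≤ 1) ∧
      (∀ p : Option (Fin n) → ℝ, (∀ x, 0 ≤ p x) → ∑ x, p x = 1 →
        (Finset.univ.filter fun x => p x ≠ 0).card ≤ l → 2 / 3 ≤ accProb a p) ∧
      ∀ p : Option (Fin n) → ℝ, (∀ x, 0 ≤ p x) → ∑ x, p x = 1 →
        (∀ i, 1 / (160 * (n : ℝ)) ≤ p (some i)) → accProb a p ≤ 1 / 3 := by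
  have hl1 : 1 ≤ l := by omega
  have hld := lvcDim_le_vcDim hd hl hl1
  obtain ⟨pts, hinj, hptsS⟩ := exists_injective_points (n := n) (S := S) (by
    rw [hn]; exact_mod_cast hS)
  have himage : ∀ s : Set (Option (Fin n)), pts '' s ⊆ S := fun s => by
    rintro _ ⟨i, -, rfl⟩; exact hptsS i
  have hsmall : ∀ (s : Finset (Option (Fin n))), s.card ≤ l → ∀ ℓ : Option (Fin n) → Bool,
      ∃ f ∈ H, ∀ i ∈ s, f (pts i) = ℓ i := fun s hs ℓ =>
    exists_mem_eq_of_shatters_image hinj (s := (s : Set (Option (Fin n))))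
      (shatters_of_encard_le_lvcDim hl hl1 (himage _) (by
        rw [hinj.encard_image, Set.encard_coe_eq_coe_finsetCard]; exact_mod_cast hs)) ℓ
  obtain ⟨ℓ, hℓ⟩ := exists_labelling_far (hl2.trans hld) hn
    {g | ∃ h ∈ H, ∀ i, g i = h (pts (some i))} fun T hT => by
      refine Shatters.card_le_of_vcDim_eq (T := (fun i => pts (some i)) '' T) (fun ℓ' => ?_)
        (by rintro _ ⟨i, -, rfl⟩; exact hptsS _) hd ?_
      · obtain ⟨g, ⟨h, hh, hgh⟩, hg⟩ := hT fun i => if hi : i ∈ T then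
          ℓ' ⟨pts (some i), Set.mem_image_of_mem (fun i => pts (some i)) hi⟩ else false
        refine ⟨h, hh, ?_⟩
        rintro ⟨_, i, hi, rfl⟩
        have := hg i hi
        rw [hgh, dif_pos (Finset.mem_coe.1 hi)] at this
        exact this
      · have hinj' : Function.Injective fun i : Fin n => pts (some i) :=
          hinj.comp (Option.some_injective _)
        rw [hinj'.encard_image, Set.encard_coe_eq_coe_finsetCard]
  -- The far labelling need not come from `H`, so a measurable extension has to be built; pairs are
  -- shattered since `l ≥ 2`.
  obtain ⟨f, hfm, hfℓ⟩ := exists_measurable_extension hH (pts := pts) (fun i j hij => by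
    obtain ⟨h, hh, hv⟩ := hsmall {i, j} (by rw [Finset.card_pair hij]; exact hl2)
      fun x => decide (x = i)
    exact ⟨h, hh, by simpa using hv i (by simp), by simpa [hij.symm] using hv j (by simp)⟩)
    fun x : Option (Fin n) => x.elim false ℓ
  refine ⟨testValue A pts (fun i => f (pts i)) true, testValue_nonneg _ _ _,
    testValue_le_one _ _ _, fun p hp hp1 hcard => ?_, fun p hp hp1 hlarge => ?_⟩
  · refine hA.two_thirds_le_accProb hH hp hp1 ?_
    obtain ⟨g, hg, hgp⟩ := hsmall _ hcard fun i => f (pts i)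
    exact ⟨g, hg, fun i hi => hgp i (by simpa using hi)⟩
  · refine hA.accProb_le_third hH hp hp1 hfm hε0 hε fun h hh => ?_
    have hfar := hℓ (fun i => h (pts (some i))) ⟨h, hh, fun _ => rfl⟩
    refine ⟨(Finset.univ.filter fun i => ℓ i ≠ h (pts (some i))).map Function.Embedding.some,
      fun i hi => ?_, ?_⟩
    · obtain ⟨j, hj, rfl⟩ := Finset.mem_map.1 hi
      rw [hfℓ]
      simpa using hj
    · rw [Finset.sum_map]
      set t := Finset.univ.filter fun i => ℓ i ≠ h (pts (some i))
      have hn0 : (0 : ℝ) < n := by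
        have : 0 < n := by omega
        exact_mod_cast this
      -- More than `d / 10` disagreements are at least a fraction `1 / 50` of the points; with
      -- masses `1 / (160 n)` this gives `1 / 8000`.
      have h1 : (n : ℝ) ≤ 50 * t.card := by
        have : n ≤ 50 * t.card := by omega
        exact_mod_cast this
      calc (1 / 8000 : ℝ) ≤ t.card * (1 / (160 * n)) := by
            rw [mul_one_div, le_div_iff₀ (by positivity)]; linarith
        _ = ∑ _i ∈ t, 1 / (160 * (n : ℝ)) := by rw [Finset.sum_const, nsmul_eq_mul]
        _ ≤ _ := Finset.sum_le_sum fun i _ => hlarge i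

/-- Every tester uses at least one sample. -/
theorem IsTester.one_le (hA : IsTester H ε m A) (hH : ∀ h ∈ H, Measurable h)
    (hd : vcDim H S = d) (hl : lvcDim H S = l) (hl2 : 2 ≤ l) (hS : 5 * (d : ℕ∞) ≤ S.encard)
    (hε0 : 0 < ε) (hε : ε < 1 / 8000) : 1 ≤ m := by
  have hld := lvcDim_le_vcDim hd hl (by omega)
  obtain ⟨n, hn⟩ : ∃ n, n + 1 = 5 * d := ⟨5 * d - 1, by omega⟩
  have hn0 : (0 : ℝ) < n := by
    have : 0 < n := by omega
    exact_mod_cast this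
  obtain ⟨a, -, -, hyes, hno⟩ := hA.exists_support_test hH hd hl hl2 hS hn hε0 hε
  rcases Nat.eq_zero_or_pos m with rfl | hm
  · exfalso
    have h1 := hyes (masses fun _ => 0) (masses_nonneg (fun _ => le_rfl) (by simp))
      (sum_masses _) (by
        refine (Finset.card_le_card (t := {none}) fun x hx => ?_).trans (by simp; omega)
        rcases x with _ | i
        · simp
        · simp [masses] at hx)
    have h2 := hno (masses fun _ => 1) (masses_nonneg (fun _ => zero_le_one) (by simp; linarith))
      (sum_masses _) fun i => le_rfl
    simp only [accProb, Finset.univ_eq_empty, Finset.prod_empty] at h1 h2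
    linarith
  · exact hm

lemma log_ge_of_two_le {x : ℝ} (hx : 2 ≤ x) : 0.69 ≤ Real.log x := by
  have := Real.log_le_log (by norm_num) hx
  linarith [Real.log_two_gt_d9]

/-- The lower bound `l / log d` for the number of samples of a tester. -/
theorem IsTester.div_log_le (hA : IsTester H ε m A) (hH : ∀ h ∈ H, Measurable h)
    (hd : vcDim H S = d) (hl : lvcDim H S = l) (hl2 : 2 ≤ l) (hS : 5 * (d : ℕ∞) ≤ S.encard)
    (hε0 : 0 < ε) (hε : ε < 1 / 8000) (hlog : 7000 * Real.log d ^ 3 ≤ l) :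
    (l : ℝ) / (512 * Real.log d) ≤ m := by
  have hld := lvcDim_le_vcDim hd hl (by omega)
  obtain ⟨n, hn⟩ : ∃ n, n + 1 = 5 * d := ⟨5 * d - 1, by omega⟩
  have hn0 : (0 : ℝ) < n := by
    have : 0 < n := by omega
    exact_mod_cast this
  have hd2 : (2 : ℝ) ≤ d := by exact_mod_cast hl2.trans hld
  have hnd : (n : ℝ) ≤ 5 * d := by
    have : n ≤ 5 * d := by omega
    exact_mod_cast this
  obtain ⟨a, ha0, ha1, hyes, hno⟩ := hA.exists_support_test hH hd hl hl2 hS hn hε0 hε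
  set L := Real.log d with hL
  have hL69 : 0.69 ≤ L := log_ge_of_two_le hd2
  have hlogn : Real.log n ≤ L + 1.75 := by
    have h5 : Real.log 5 ≤ 1.75 := by
      rw [Real.log_le_iff_le_exp (by norm_num)]
      have e : Real.exp 1.75 = Real.exp 1 * Real.exp 0.75 := by rw [← Real.exp_add]; norm_num
      have h1 := Real.exp_one_gt_d9
      have h2 := Real.quadratic_le_exp_of_nonneg (show (0 : ℝ) ≤ 0.75 by norm_num)
      rw [e]
      nlinarith
    have := Real.log_le_log hn0 hnd
    rw [Real.log_mul (by norm_num) (by linarith)] at this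
    linarith
  -- Then `n * exp (-(M + 2)) ≤ exp (-4)`, small enough for a replacement error summed over `n`
  -- coordinates, while `M` is still of order `log d`.
  set M := ⌈Real.log n⌉₊ + 2 with hMdef
  have hM1 : Real.log n + 2 ≤ M := by
    rw [hMdef]; push_cast; linarith [Nat.le_ceil (Real.log n)]
  have hM2 : (M : ℝ) ≤ 8 * L := by
    have h0 : 0 ≤ Real.log n := Real.log_natCast_nonneg n
    have := (Nat.ceil_lt_add_one h0).le
    rw [hMdef]; push_cast; linarith
  have hM0 : (2 : ℝ) ≤ M := by rw [hMdef]; push_cast; linarith [Nat.cast_nonneg (α := ℝ) ⌈Real.log n⌉₊]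
  by_contra! hlt
  have hLpos : 0 < L := by linarith
  rw [lt_div_iff₀ (by positivity)] at hlt
  refine not_distinguishes_support (M := M) ha0 ha1 (by omega : 1 ≤ l) (by omega) ?_ ?_ ?_ hyes hno
  · have h4 : Real.exp (-(M + 2)) ≤ Real.exp (-Real.log n) * Real.exp (-4) := by
      rw [← Real.exp_add, Real.exp_le_exp]; linarith
    rw [Real.exp_neg (Real.log n), Real.exp_log hn0] at h4
    have h5 : Real.exp (-4) ≤ 1 / 20 := by
      rw [Real.exp_neg, ← one_div]
      refine one_div_le_one_div_of_le (by norm_num) ?_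
      have e : Real.exp 4 = Real.exp 1 * Real.exp 1 * (Real.exp 1 * Real.exp 1) := by
        simp_rw [← Real.exp_add]; norm_num
      have h1 := Real.exp_one_gt_d9
      have : 7 ≤ Real.exp 1 * Real.exp 1 := by nlinarith
      rw [e]
      nlinarith
    calc (n : ℝ) * Real.exp (-(M + 2)) ≤ n * ((n : ℝ)⁻¹ * (1 / 20)) := by
          gcongr
          exact h4.trans (by gcongr)
      _ = 1 / 20 := by field_simp
  · calc 2 * (1 + 4 * (M : ℝ) ^ 2) * (M + 3) ≤ 2 * (1 + 4 * (8 * L) ^ 2) * (8 * L + 3) := by gcongr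
      _ ≤ 2 * (259 * L ^ 2) * (13 * L) := by
          gcongr
          · nlinarith
          · linarith
      _ ≤ 7000 * L ^ 3 := by nlinarith [pow_pos hLpos 3]
      _ ≤ l := hlog
  · have h1 : (m : ℝ) * (64 * M) ≤ l := by
      have : (m : ℝ) * (64 * M) ≤ m * (512 * L) :=
        mul_le_mul_of_nonneg_left (by linarith) (by positivity)
      linarith
    have hm0 : (0 : ℝ) ≤ m := by positivity
    have h2 : 1 + 4 * (M : ℝ) ^ 2 ≤ 4 * M * (M + 2) := by nlinarith
    calc 16 * m * (1 + 4 * (M : ℝ) ^ 2) ≤ 16 * m * (4 * M * (M + 2)) := by gcongr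
      _ = (m * (64 * M)) * (M + 2) := by ring
      _ ≤ l * (M + 2) := by gcongr

lemma ofReal_le_sampleComplexity {r : ℝ}
    (h : ∀ (m : ℕ) (A : (Fin m → X × Bool) → PMF Bool), IsTester H ε m A → r ≤ m) :
    ENNReal.ofReal r ≤ (sampleComplexity H ε : ℝ≥0∞) := by
  have h1 : (⌈r⌉₊ : ℕ∞) ≤ sampleComplexity H ε :=
    le_iInf₂ fun m ⟨A, hA⟩ => Nat.cast_le.2 (Nat.ceil_le.2 (h m A hA))
  calc ENNReal.ofReal r ≤ ENNReal.ofReal (⌈r⌉₊ : ℝ) := ENNReal.ofReal_le_ofReal (Nat.le_ceil r)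
    _ = (((⌈r⌉₊ : ℕ) : ℕ∞) : ℝ≥0∞) := by simp
    _ ≤ _ := ENat.toENNReal_le.2 h1

end LowerBound

/-! ### Comparison of the bounds and conclusion -/

/-- The exponent `3 / 10` is chosen so that the fifth power of `log x ≤ x ^ (3 / 10) / (3 / 10)`
involves `x ^ (3 / 2)`, the square of `x ^ (3 / 4)`. -/
lemma log_cube_le_rpow_mul_sqrt {x : ℝ} (hx : 2 ≤ x) :
    Real.log x ^ 3 ≤ 25 * (x ^ (3 / 4 : ℝ) * Real.sqrt (Real.log x)) := by
  have hL : 0 < Real.log x := Real.log_pos (by linarith)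
  have hx0 : 0 ≤ x := by linarith
  have h1 : Real.log x ≤ x ^ (3 / 10 : ℝ) / (3 / 10) :=
    Real.log_le_rpow_div hx0 (by norm_num)
  set s := Real.sqrt (Real.log x) with hs
  have hs2 : s ^ 2 = Real.log x := Real.sq_sqrt hL.le
  have h2 : s ^ 5 ≤ 25 * x ^ (3 / 4 : ℝ) := by
    refine le_of_pow_le_pow_left₀ (n := 2) (by norm_num) (by positivity) ?_
    have e1 : (s ^ 5) ^ 2 = Real.log x ^ 5 := by rw [← hs2]; ring
    have e2 : (x ^ (3 / 10 : ℝ)) ^ 5 = (x ^ (3 / 4 : ℝ)) ^ 2 := by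
      rw [← Real.rpow_mul_natCast hx0, ← Real.rpow_mul_natCast hx0]
      norm_num
    calc (s ^ 5) ^ 2 = Real.log x ^ 5 := e1
      _ ≤ (x ^ (3 / 10 : ℝ) / (3 / 10)) ^ 5 := by gcongr
      _ = (10 / 3) ^ 5 * (x ^ (3 / 4 : ℝ)) ^ 2 := by rw [← e2]; ring
      _ ≤ 25 ^ 2 * (x ^ (3 / 4 : ℝ)) ^ 2 := by gcongr; norm_num
      _ = _ := by ring
  calc Real.log x ^ 3 = s ^ 5 * s := by rw [← hs2]; ring
    _ ≤ 25 * x ^ (3 / 4 : ℝ) * s := by gcongr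
    _ = _ := by ring

lemma div_log_le_of_lt {x : ℝ} (hx : 2 ≤ x) (h : x < 7000 * Real.log x ^ 3) :
    x / Real.log x ≤ 10 ^ 13 := by
  have hx0 : 0 ≤ x := by linarith
  have hL := log_ge_of_two_le hx
  have h1 : Real.log x ≤ x ^ (1 / 6 : ℝ) / (1 / 6) := Real.log_le_rpow_div hx0 (by norm_num)
  set y := x ^ (1 / 6 : ℝ) with hy
  have hy6 : y ^ 6 = x := by
    rw [hy, ← Real.rpow_mul_natCast hx0]; norm_num
  have hy0 : 0 < y := Real.rpow_pos_of_pos (by linarith) _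
  have h2 : y ^ 3 * y ^ 3 < 1512000 * y ^ 3 := by
    calc y ^ 3 * y ^ 3 = x := by rw [← hy6]; ring
      _ < 7000 * Real.log x ^ 3 := h
      _ ≤ 7000 * (y / (1 / 6)) ^ 3 := by gcongr
      _ = _ := by ring
  have h3 : y ^ 3 < 1512000 := lt_of_mul_lt_mul_right h2 (by positivity)
  have h4 : x ≤ 1512000 * 1512000 := by
    rw [← hy6, show y ^ 6 = y ^ 3 * y ^ 3 by ring]
    gcongr
  rw [div_le_iff₀ (by linarith)]
  linarith

end SampleTesting

theorem mainTheorem1 :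
    ∃ C ε₀ c : ℝ, 0 < C ∧ 0 < ε₀ ∧ 0 < c ∧
      ∀ (X : Type u) [MeasurableSpace X] (H : Set (X → Bool)), (∀ h ∈ H, Measurable h) →
      ∀ (S : Set X) (d l : ℕ),
        SampleTesting.vcDim H S = d → SampleTesting.lvcDim H S = l → 2 ≤ d →
        5 * (d : ℕ∞) ≤ S.encard →
        (C * (d : ℝ) ^ (3 / 4 : ℝ) * Real.sqrt (Real.log d) ≤ l →
          ∀ ε : ℝ, 0 < ε → ε < ε₀ →
            ENNReal.ofReal (c * ((l : ℝ) ^ 2 / (d * Real.log d))) ≤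
              (SampleTesting.sampleComplexity H ε : ℝ≥0∞)) ∧
        (l = d →
          ∀ ε : ℝ, 0 < ε → ε < ε₀ →
            ENNReal.ofReal (c * ((d : ℝ) / Real.log d)) ≤
              (SampleTesting.sampleComplexity H ε : ℝ≥0∞)) := by
  -- `175000 = 7000 * 25` turns the hypothesis on `l` into `7000 * log d ^ 3 ≤ l`; the tiny `c` is
  -- needed only for bounded `d` in the second part.
  refine ⟨175000, 1 / 8000, 1 / 10 ^ 13, by norm_num, by norm_num, by norm_num, ?_⟩
  intro X _ H hH S d l hd hl hd2 hS
  have hd2' : (2 : ℝ) ≤ d := by exact_mod_cast hd2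
  have hL := SampleTesting.log_ge_of_two_le hd2'
  have hL0 : 0 < Real.log d := by linarith
  refine ⟨fun hlarge ε hε0 hε => ?_, fun hld ε hε0 hε => ?_⟩
  · refine SampleTesting.ofReal_le_sampleComplexity fun m A hA => ?_
    have hlog : 7000 * Real.log d ^ 3 ≤ l := by
      linarith [SampleTesting.log_cube_le_rpow_mul_sqrt hd2']
    have hl2' : (2 : ℝ) ≤ l := by
      have : (0.69 : ℝ) ^ 3 ≤ Real.log d ^ 3 := by gcongr
      norm_num at this
      linarith
    have hl2 : 2 ≤ l := by exact_mod_cast hl2'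
    have hld : (l : ℝ) ≤ d := by
      exact_mod_cast SampleTesting.lvcDim_le_vcDim hd hl (by omega)
    refine le_trans ?_ (hA.div_log_le hH hd hl hl2 hS hε0 hε hlog)
    -- As `l ≤ d`, the bound already obtained is the stronger one.
    have h1 : (l : ℝ) ^ 2 / (d * Real.log d) ≤ l / Real.log d := by
      rw [div_le_div_iff₀ (by positivity) hL0]
      calc (l : ℝ) ^ 2 * Real.log d = l * l * Real.log d := by ring
        _ ≤ l * d * Real.log d := by gcongr
        _ = _ := by ring
    calc 1 / 10 ^ 13 * ((l : ℝ) ^ 2 / (d * Real.log d)) ≤ 1 / 512 * (l / Real.log d) := by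
          gcongr
          norm_num
      _ = _ := by field_simp
  · subst hld
    refine SampleTesting.ofReal_le_sampleComplexity fun m A hA => ?_
    -- In the second case `l` is bounded and the claimed bound is at most `1`.
    rcases le_or_gt (7000 * Real.log l ^ 3) (l : ℝ) with hlog | hlog
    · refine le_trans ?_ (hA.div_log_le hH hd hl hd2 hS hε0 hε hlog)
      calc 1 / 10 ^ 13 * ((l : ℝ) / Real.log l) ≤ 1 / 512 * (l / Real.log l) := by
            gcongr
            norm_num
        _ = _ := by field_simp
    · have h1 : (1 : ℝ) ≤ m := by exact_mod_cast hA.one_le hH hd hl hd2 hS hε0 hε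
      have h2 := SampleTesting.div_log_le_of_lt hd2' hlog
      linarith
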